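/- Let $n\geq 2$ and let $K\subset\mathbb{H}^{n+1}$ be a compact, geodesically convex set with non-empty interior and smooth boundary. Let $R$ be its outradius, that is, the radius of the smallest closed geodesic ball of $\mathbb{H}^{n+1}$ containing $K$. Suppose that $\partial K$ is pointwise strictly $1/2$-pinched: at every point of $\partial K$, the principal curvatures $\lambda_1\leq\dots\leq\lambda_n$ of $\partial K$ (with respect to the hyperbolic metric and the outward unit normal, with the sign for which geodesic spheres have positive curvature) satisfy $\lambda_1>\frac{1}{2}H$, where $H=\frac{1}{n}(\lambda_1+\dots+\lambda_n)$. Then $K$ contains a closed geodesic ball of radius $$\rho=\frac{\sqrt{2}}{(n+1)(n+2)}\,\frac{\tanh R}{\cosh^2 R}.$$ In particular, if $R=\tanh^{-1}(1/\sqrt{3})$, then $\rho=\sqrt{\frac{8}{27}}\,\frac{1}{(n+1)(n+2)}$, and $K$ contains a closed geodesic ball of this radius. -/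

import Mathlib

open scoped ContDiff

noncomputable section

namespace Hyp

/-- Minkowski space `ℝ^{m,1}`: pairs `(t, x)` of a time coordinate and a space coordinate
`x ∈ ℝ^m`. (The norm of the product is only used for its topology and for differentiation.) -/
abbrev Mink (m : ℕ) : Type := ℝ × EuclideanSpace ℝ (Fin m)

/-- The Minkowski form `⟨(s, x), (t, y)⟩ = x · y - s t` of signature `(m, 1)`. -/
def form {m : ℕ} (u v : Mink m) : ℝ := inner ℝ u.2 v.2 - u.1 * v.1

/-- Hyperbolic space `ℍ^m` (hyperboloid model): the vectors of Minkowski square `-1` with positive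
time coordinate, with the subspace topology. Its Riemannian metric is the restriction of the
Minkowski form to the tangent spaces `T_p ℍ^m = {X | ⟨p, X⟩ = 0}`. -/
abbrev HSpace (m : ℕ) : Type := {p : Mink m // form p p = -1 ∧ 0 < p.1}

/-- The geodesic (hyperbolic) distance, `cosh d(p, q) = -⟨p, q⟩`. -/
def hdist {m : ℕ} (p q : HSpace m) : ℝ := Real.arcosh (-form p.1 q.1)

/-- The closed geodesic ball of centre `c` and radius `r`. -/
def geodesicBall {m : ℕ} (c : HSpace m) (r : ℝ) : Set (HSpace m) := {q | hdist c q ≤ r}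

/-- The geodesic of `ℍ^m` starting at `p` with unit initial velocity `v`, at time `t`. -/
def geodesic {m : ℕ} (p v : Mink m) (t : ℝ) : Mink m := Real.cosh t • p + Real.sinh t • v

/-- Geodesic convexity: a geodesic arc whose two end points lie in `K` lies in `K`. -/
def GeodesicallyConvex {m : ℕ} (K : Set (HSpace m)) : Prop :=
  ∀ (p q : HSpace m) (v : Mink m) (L : ℝ), p ∈ K → q ∈ K → form p.1 v = 0 → form v v = 1 →
    0 ≤ L → geodesic p.1 v L = q.1 →
    ∀ (t : ℝ) (z : HSpace m), 0 ≤ t → t ≤ L → geodesic p.1 v t = z.1 → z ∈ K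

/-- `R` is the outradius of `K`: the radius of the smallest geodesic ball containing `K`. -/
def IsOutradius {m : ℕ} (K : Set (HSpace m)) (R : ℝ) : Prop :=
  IsLeast {r : ℝ | 0 ≤ r ∧ ∃ c : HSpace m, K ⊆ geodesicBall c r} R

/-- The gradient of `f` with respect to the Minkowski form, see `form_minkGrad`. -/
def minkGrad {m : ℕ} (f : Mink m → ℝ) (x : Mink m) : Mink m :=
  (-(fderiv ℝ f x (1, 0)),
    WithLp.toLp 2 fun i => fderiv ℝ f x (0, EuclideanSpace.single i (1 : ℝ)))

/-- At a point `x` of `ℍ^m`, the gradient of the restriction of `f` to `ℍ^m`: the projection of the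
Minkowski gradient to the tangent space `{X | ⟨x, X⟩ = 0}` along the normal `x`. -/
def hypGrad {m : ℕ} (f : Mink m → ℝ) (x : Mink m) : Mink m :=
  minkGrad f x + form (minkGrad f x) x • x

/-- The normalised gradient of `f`: along the hypersurface `{f = 0} ⊆ ℍ^m` this is the unit normal
vector field that points out of `{f ≤ 0}`. -/
def unitNormal {m : ℕ} (f : Mink m → ℝ) (x : Mink m) : Mink m :=
  (Real.sqrt (form (hypGrad f x) (hypGrad f x)))⁻¹ • hypGrad f x

/-- `f` is a smooth defining function of `K` near `p`: near `p`, `K` is `{f ≤ 0}`, and the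
restriction of `f` to `ℍ^m` has non-zero differential at `p`. -/
structure IsDefiningFunctionAt {m : ℕ} (K : Set (HSpace m)) (p : HSpace m) (f : Mink m → ℝ) :
    Prop where
  smooth : ContDiff ℝ ∞ f
  mem_iff : ∀ᶠ q : HSpace m in nhds p, q ∈ K ↔ f q.1 ≤ 0
  regular : ∃ X : Mink m, form p.1 X = 0 ∧ fderiv ℝ f p.1 X ≠ 0

/-- `K` has smooth boundary: near each boundary point it has a smooth defining function. -/
def HasSmoothBoundary {m : ℕ} (K : Set (HSpace m)) : Prop :=
  ∀ p ∈ frontier K, ∃ f : Mink m → ℝ, IsDefiningFunctionAt K p f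

/-- `X` is tangent at `p` to the hypersurface of `ℍ^m` on which `f` equals `f p`. -/
def IsTangent {m : ℕ} (f : Mink m → ℝ) (p : HSpace m) (X : Mink m) : Prop :=
  form p.1 X = 0 ∧ fderiv ℝ f p.1 X = 0

/-- `κ 0, …, κ (n-1)` are the principal curvatures at `p`, with multiplicity, of the hypersurface
`{f = 0}` of `ℍ^{n+1}`: there is an orthonormal basis `e` of its tangent space (which has
dimension `n`) with `A e_i = κ_i e_i`, where `A X = ∇_X N` is the shape operator for the unit
normal `N`. Since `⟨N, x⟩ = 0` on `ℍ^{n+1}`, one has `⟨D_X N, p⟩ = -⟨N, X⟩ = 0` for `X` tangent to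
the hypersurface, so that `∇_X N` is just the derivative `D_X N` in Minkowski space. -/
def IsPrincipalCurvatures {n : ℕ} (f : Mink (n + 1) → ℝ) (p : HSpace (n + 1)) (κ : Fin n → ℝ) :
    Prop :=
  ∃ e : Fin n → Mink (n + 1),
    (∀ i, IsTangent f p (e i)) ∧
    (∀ i j, form (e i) (e j) = if i = j then 1 else 0) ∧
    ∀ i, fderiv ℝ (unitNormal f) p.1 (e i) = κ i • e i

/-- The boundary of `K ⊆ ℍ^{n+1}` is pointwise strictly `1/2`-pinched: at each boundary point, each
principal curvature (equivalently, the smallest one) is greater than half of the mean curvature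
`H = (κ_1 + … + κ_n) / n`. Principal curvatures are taken with respect to the outward normal and do
not depend on the defining function. -/
def IsStrictlyHalfPinched {n : ℕ} (K : Set (HSpace (n + 1))) : Prop :=
  ∀ p ∈ frontier K, ∀ f : Mink (n + 1) → ℝ, IsDefiningFunctionAt K p f →
    ∀ κ : Fin n → ℝ, IsPrincipalCurvatures f p κ →
      ∀ i, (1 / 2 : ℝ) * ((∑ j, κ j) / (n : ℝ)) < κ i

theorem form_minkGrad {m : ℕ} (f : Mink m → ℝ) (x v : Mink m) :
    form (minkGrad f x) v = fderiv ℝ f x v := by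
  obtain ⟨t, y⟩ := v
  have hy : (∑ i, y i • EuclideanSpace.single i (1 : ℝ)) = y := by
    ext j
    simp [Finset.sum_apply, Pi.single_apply]
  have h : ((t, y) : Mink m)
      = t • (1, 0) + ∑ i, y i • ((0, EuclideanSpace.single i (1 : ℝ)) : Mink m) := by
    refine Prod.ext ?_ ?_
    · simp [Prod.fst_sum]
    · simpa [Prod.snd_sum] using hy.symm
  rw [h, map_add, map_smul, map_sum, ← h]
  simp only [map_smul, form, minkGrad, PiLp.inner_apply]
  simp
  ring

theorem form_hypGrad {m : ℕ} (f : Mink m → ℝ) (p : HSpace m) :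
    form (hypGrad f p.1) p.1 = 0 := by
  have h := p.2.1
  simp only [form] at h
  simp only [hypGrad, form, Prod.fst_add, Prod.snd_add, Prod.smul_fst, Prod.smul_snd,
    inner_add_left, real_inner_smul_left, smul_eq_mul]
  linear_combination (inner ℝ (minkGrad f p.1).2 p.1.2 - (minkGrad f p.1).1 * p.1.1) * h

end Hyp

end

/-!
The Klein model centred at the circumcentre of `K` turns the statement into Euclidean convex
geometry. It maps `K` to a convex body `C` in the ball of radius `tanh R`, and the circumscribed
sphere touches `C` in two points seen from the centre under an angle of at least `π / 2`, so that
some width of `C` is at least `√2 tanh R` (`Hyp.exists_far_points`).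

Hyperbolic geodesics are straight lines in this model, so the hyperbolic and the Euclidean second
fundamental forms of the boundary are proportional. The pinching condition places all principal
curvatures between `H / 2` and `(n + 1) H / 2`, and the two metrics on tangent vectors differ by a
factor between `cosh² d` and `cosh⁴ d`, where `d ≤ R` is the distance from the centre. Hence the
Euclidean second fundamental form of the boundary of `C` is pinched with ratio
`A = (n + 1) cosh² R` (`Hyp.isPinchedNormalAt_kleinNormal`). In particular the Gauss map can be
inverted: the support point `X u` of `C` in direction `u` is a differentiable function of `u`, and
the form `⟪DX η, η⟫`, the second derivative of the support function, is pinched with the same ratio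
(`exists_supportPoint_differentiable`).

Pointwise pinching by `A` bounds the ratio of any two widths by `A` (`width_le_mul_width`). The
width in direction `u` is the integral of `⟪DX u, u⟫` over any line in direction `u` that avoids the
origin. Given unit vectors `u` and `v`, choose a unit vector `e` orthogonal to both, which is
possible in dimension at least three, and integrate over the plane of the points
`z = e + s u + t v`. With `k = 1 - ⟪u, v⟫²` the pinching at `z` reads
`⟪DX u, u⟫ / (1 + k t²) ≤ A ⟪DX v, v⟫ / (1 + k s²)`, and by Tonelli's theorem the integrals of the
two sides are the widths in directions `u` and `v` times the same constant.

So all widths of `C` are at least `√2 tanh R / A`. By Helly's theorem a convex body of dimension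
`n + 1` with all widths at least `w` contains a ball of radius `w / (n + 2)`
(`exists_closedBall_subset_of_width`). Since the Klein chart does not increase distances
(`Hyp.dist_kleinCoord_le_hdist`), the hyperbolic ball with the same centre and radius lies in `K`.
-/

open MeasureTheory Filter Topology Set

/-! ### Widths of a convex body with pinched Gauss map -/

theorem lintegral_deriv_of_nonneg {g g' : ℝ → ℝ} {a b : ℝ}
    (hg : ∀ x, HasDerivAt g (g' x) x) (h0 : ∀ x, 0 ≤ g' x)
    (ha : Tendsto g atBot (𝓝 a)) (hb : Tendsto g atTop (𝓝 b)) :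
    ∫⁻ x, ENNReal.ofReal (g' x) = ENNReal.ofReal (b - a) := by
  have h1 : IntegrableOn g' (Ioi 0) :=
    integrableOn_Ioi_deriv_of_nonneg' (fun x _ => hg x) (fun x _ => h0 x) hb
  have h2 : IntegrableOn (fun x => g' (-x)) (Ioi 0) := by
    refine integrableOn_Ioi_deriv_of_nonneg' (g := fun x => -g (-x)) (l := -a)
      (fun x _ => ?_) (fun x _ => h0 _) ?_
    · have : HasDerivAt (fun x => -g (-x)) (-(g' (-x) * -1)) x :=
        ((hg (-x)).comp x (hasDerivAt_neg x)).neg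
      simpa using this
    · exact (ha.comp tendsto_neg_atTop_atBot).neg
  have h3 : IntegrableOn g' (Iio 0) := by
    have h := (Measure.measurePreserving_neg (volume : Measure ℝ)).integrableOn_comp_preimage
      (Homeomorph.neg ℝ).measurableEmbedding (f := g') (s := Iio 0)
    rw [← h]
    simpa [Function.comp_def] using h2
  have h4 : Integrable g' := by
    rw [← integrableOn_univ, ← Iic_union_Ioi (a := (0 : ℝ))]
    exact ((integrableOn_Iic_iff_integrableOn_Iio).2 h3).union h1
  rw [← ofReal_integral_eq_lintegral_ofReal h4 (ae_of_all _ h0),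
    integral_of_hasDerivAt_of_tendsto hg h4 ha hb]

section Width

variable {E : Type*} [NormedAddCommGroup E] [InnerProductSpace ℝ E]

/-- `X u` is a point of `C` at which the linear form `⟪·, u⟫` is maximal on `C`. -/
structure IsSupportPoint (C : Set E) (u x : E) : Prop where
  mem : x ∈ C
  le : ∀ y ∈ C, inner ℝ y u ≤ inner ℝ x u

/-- Along a ray in direction `u`, the `u`-component of the support points converges to the value
at `u` of the support function. -/
theorem tendsto_inner_supportPoint {C : Set E} {X : E → E} {M : ℝ}
    (hM : ∀ x ∈ C, ‖x‖ ≤ M) (hX : ∀ u, u ≠ 0 → IsSupportPoint C u (X u))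
    {u y : E} (hu : u ≠ 0) (hne : ∀ t : ℝ, y + t • u ≠ 0) :
    Tendsto (fun t : ℝ => inner ℝ (X (y + t • u)) u) atTop (𝓝 (inner ℝ (X u) u)) := by
  have hlim : Tendsto (fun t : ℝ => inner ℝ (X u) u - (2 * M * ‖y‖) * t⁻¹) atTop
      (𝓝 (inner ℝ (X u) u)) := by
    have := (tendsto_inv_atTop_zero (𝕜 := ℝ)).const_mul (2 * M * ‖y‖)
    simpa using this.const_sub (inner ℝ (X u) u)
  refine tendsto_of_tendsto_of_tendsto_of_le_of_le' hlim tendsto_const_nhds ?_ ?_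
  · filter_upwards [eventually_gt_atTop 0] with t ht
    have h1 := (hX _ (hne t)).le _ (hX u hu).mem
    have h2 : |inner ℝ (X u - X (y + t • u)) y| ≤ ‖X u - X (y + t • u)‖ * ‖y‖ :=
      abs_real_inner_le_norm _ _
    have h3 : ‖X u - X (y + t • u)‖ ≤ 2 * M := by
      have := norm_sub_le (X u) (X (y + t • u))
      linarith [hM _ (hX u hu).mem, hM _ (hX _ (hne t)).mem]
    have h4 := mul_le_mul_of_nonneg_right h3 (norm_nonneg y)
    have h5 := (abs_le.1 h2).1
    simp only [inner_add_right, inner_sub_left, inner_smul_right] at h1 h5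
    have h6 : t * inner ℝ (X u) u - 2 * M * ‖y‖ ≤ t * inner ℝ (X (y + t • u)) u := by linarith
    have h7 := mul_le_mul_of_nonneg_left h6 (inv_nonneg.2 ht.le)
    rw [mul_sub, inv_mul_cancel_left₀ ht.ne', inv_mul_cancel_left₀ ht.ne'] at h7
    linarith [mul_comm t⁻¹ (2 * M * ‖y‖)]
  · exact Eventually.of_forall fun t => (hX u hu).le _ (hX _ (hne t)).mem

/-- The width in direction `u` is the integral of the second derivative of the support function
along every line in direction `u` that avoids the origin. -/
theorem lintegral_inner_fderiv_supportPoint {C : Set E} {X : E → E} {M : ℝ}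
    (hM : ∀ x ∈ C, ‖x‖ ≤ M) (hX : ∀ u, u ≠ 0 → IsSupportPoint C u (X u))
    (hd : ∀ u, u ≠ 0 → DifferentiableAt ℝ X u)
    (hp : ∀ z, z ≠ 0 → ∀ η, 0 ≤ inner ℝ (fderiv ℝ X z η) η)
    {u y : E} (hu : u ≠ 0) (hne : ∀ t : ℝ, y + t • u ≠ 0) :
    ∫⁻ t : ℝ, ENNReal.ofReal (inner ℝ (fderiv ℝ X (y + t • u) u) u) =
      ENNReal.ofReal (inner ℝ (X u) u - inner ℝ (X (-u)) u) := by
  refine lintegral_deriv_of_nonneg (g := fun t => inner ℝ (X (y + t • u)) u)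
    (fun t => ?_) (fun t => hp _ (hne t) u) ?_ (tendsto_inner_supportPoint hM hX hu hne)
  · have h1 : HasDerivAt (fun t : ℝ => y + t • u) u t := by
      simpa using ((hasDerivAt_id t).smul_const u).const_add y
    have h2 := (hd _ (hne t)).hasFDerivAt.comp_hasDerivAt t h1
    simpa using h2.inner ℝ (hasDerivAt_const t u)
  · have h := tendsto_inner_supportPoint hM hX (neg_ne_zero.2 hu) (y := y)
      (fun t => by simpa using hne (-t))
    have h' := (h.comp tendsto_neg_atBot_atTop).neg
    simpa [Function.comp_def] using h'

theorem lintegral_inv_one_add_mul_sq_ne_top {k : ℝ} (hk : 0 < k) (hk1 : k ≤ 1) :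
    ∫⁻ t : ℝ, ENNReal.ofReal ((1 + k * t ^ 2)⁻¹) ≠ ⊤ := by
  have h : Integrable (fun t : ℝ => k⁻¹ * (1 + t ^ 2)⁻¹) := integrable_inv_one_add_sq.const_mul _
  refine ne_top_of_le_ne_top h.lintegral_lt_top.ne (lintegral_mono fun t => ?_)
  refine ENNReal.ofReal_le_ofReal ?_
  rw [← mul_inv]
  refine inv_anti₀ (by positivity) ?_
  nlinarith [sq_nonneg t]

theorem lintegral_inv_one_add_mul_sq_ne_zero {k : ℝ} (hk : 0 < k) :
    ∫⁻ t : ℝ, ENNReal.ofReal ((1 + k * t ^ 2)⁻¹) ≠ 0 := by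
  have hm : Measurable fun t : ℝ => ENNReal.ofReal ((1 + k * t ^ 2)⁻¹) := by fun_prop
  rw [← pos_iff_ne_zero, lintegral_pos_iff_support hm]
  have : Function.support (fun t : ℝ => ENNReal.ofReal ((1 + k * t ^ 2)⁻¹)) = univ := by
    refine eq_univ_of_forall fun t => ?_
    have : 0 < (1 + k * t ^ 2)⁻¹ := by positivity
    simpa [Function.mem_support] using this
  rw [this]
  simp

variable [FiniteDimensional ℝ E]

/-- If the principal radii of curvature at each single boundary point have ratio at most `A`, then
any two widths have ratio at most `A`. Both sides are integrals over the affine plane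
`e + span {u, v}`, where `e` is orthogonal to `u` and `v`; there the pinching compares the two
integrands pointwise. -/
theorem width_le_mul_width_of_linearIndependent {C : Set E} {X : E → E} {M A : ℝ} (hA : 0 ≤ A)
    (hM : ∀ x ∈ C, ‖x‖ ≤ M) (hX : ∀ u, u ≠ 0 → IsSupportPoint C u (X u))
    (hd : ∀ u, u ≠ 0 → DifferentiableAt ℝ X u)
    (hp : ∀ z, z ≠ 0 → ∀ η, 0 ≤ inner ℝ (fderiv ℝ X z η) η)
    (hpinch : ∀ z, z ≠ 0 → ∀ η ζ,
      inner ℝ (fderiv ℝ X z η) η * (‖ζ‖ ^ 2 * ‖z‖ ^ 2 - inner ℝ ζ z ^ 2) ≤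
        A * (inner ℝ (fderiv ℝ X z ζ) ζ * (‖η‖ ^ 2 * ‖z‖ ^ 2 - inner ℝ η z ^ 2)))
    {e u v : E} (he : ‖e‖ = 1) (hu : ‖u‖ = 1) (hv : ‖v‖ = 1) (heu : inner ℝ e u = 0)
    (hev : inner ℝ e v = 0) (huv : inner ℝ u v ^ 2 < 1) :
    inner ℝ (X u) u - inner ℝ (X (-u)) u ≤ A * (inner ℝ (X v) v - inner ℝ (X (-v)) v) := by
  set c : ℝ := inner ℝ u v with hc
  set k : ℝ := 1 - c ^ 2 with hk
  have hk0 : 0 < k := by linarith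
  have hk1 : k ≤ 1 := by nlinarith [sq_nonneg c]
  have hu0 : u ≠ 0 := by rintro rfl; simp at hu
  have hv0 : v ≠ 0 := by rintro rfl; simp at hv
  have hee : inner ℝ e e = (1 : ℝ) := by rw [real_inner_self_eq_norm_sq, he]; norm_num
  have huu : inner ℝ u u = (1 : ℝ) := by rw [real_inner_self_eq_norm_sq, hu]; norm_num
  have hvv : inner ℝ v v = (1 : ℝ) := by rw [real_inner_self_eq_norm_sq, hv]; norm_num
  have hue : inner ℝ u e = (0 : ℝ) := by rw [real_inner_comm]; exact heu
  have hve : inner ℝ v e = (0 : ℝ) := by rw [real_inner_comm]; exact hev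
  have hvu : inner ℝ v u = c := by rw [real_inner_comm]
  let z : ℝ → ℝ → E := fun s t => e + s • u + t • v
  have hz2 : ∀ s t, ‖z s t‖ ^ 2 = 1 + s ^ 2 + t ^ 2 + 2 * c * s * t := by
    intro s t
    rw [← real_inner_self_eq_norm_sq]
    simp only [z, inner_add_left, inner_add_right, inner_smul_left, inner_smul_right, hee, huu,
      hvv, heu, hev, hue, hve, hvu, ← hc]
    simp
    ring
  have hz0 : ∀ s t, z s t ≠ 0 := by
    intro s t h
    have := hz2 s t
    rw [h] at this
    simp at this
    nlinarith [sq_nonneg (s + c * t), mul_nonneg hk0.le (sq_nonneg t)]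
  let q : E → ℝ → ℝ → ℝ := fun w s t => inner ℝ (fderiv ℝ X (z s t) w) w
  have hq0 : ∀ w s t, 0 ≤ q w s t := fun w s t => hp _ (hz0 s t) w
  have hcomp : ∀ s t, q u s t * (1 + k * t ^ 2)⁻¹ ≤ A * (q v s t * (1 + k * s ^ 2)⁻¹) := by
    intro s t
    have h := hpinch _ (hz0 s t) u v
    have e1 : ‖v‖ ^ 2 * ‖z s t‖ ^ 2 - inner ℝ v (z s t) ^ 2 = 1 + k * s ^ 2 := by
      rw [hz2, hv]
      simp only [z, inner_add_right, inner_smul_right, hve, hvu, hvv]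
      rw [hk]; ring
    have e2 : ‖u‖ ^ 2 * ‖z s t‖ ^ 2 - inner ℝ u (z s t) ^ 2 = 1 + k * t ^ 2 := by
      rw [hz2, hu]
      simp only [z, inner_add_right, inner_smul_right, hue, ← hc, huu]
      rw [hk]; ring
    rw [e1, e2] at h
    change q u s t * (1 + k * s ^ 2) ≤ A * (q v s t * (1 + k * t ^ 2)) at h
    have p1 : 0 < 1 + k * t ^ 2 := by positivity
    have p2 : 0 < 1 + k * s ^ 2 := by positivity
    rw [← div_eq_mul_inv, ← div_eq_mul_inv, ← mul_div_assoc, div_le_div_iff₀ p1 p2]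
    linarith
  have hzc : Continuous fun p : ℝ × ℝ => z p.1 p.2 := by fun_prop
  borelize E
  have hqm : ∀ w, Measurable fun p : ℝ × ℝ => q w p.1 p.2 := by
    intro w
    have := (measurable_fderiv_apply_const ℝ X w).comp hzc.measurable
    exact this.inner measurable_const
  set I : ENNReal := ∫⁻ t : ℝ, ENNReal.ofReal ((1 + k * t ^ 2)⁻¹) with hI
  have hI0 : I ≠ 0 := lintegral_inv_one_add_mul_sq_ne_zero hk0
  have hI1 : I ≠ ⊤ := lintegral_inv_one_add_mul_sq_ne_top hk0 hk1
  have hku : ∀ t, ∫⁻ s, ENNReal.ofReal (q u s t) =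
      ENNReal.ofReal (inner ℝ (X u) u - inner ℝ (X (-u)) u) := by
    intro t
    have e1 : ∀ s, z s t = (e + t • v) + s • u := fun s => by simp only [z]; abel
    have h := lintegral_inner_fderiv_supportPoint hM hX hd hp hu0 (y := e + t • v)
      (fun s => by rw [← e1]; exact hz0 s t)
    simpa only [q, e1] using h
  have hkv : ∀ s, ∫⁻ t, ENNReal.ofReal (q v s t) =
      ENNReal.ofReal (inner ℝ (X v) v - inner ℝ (X (-v)) v) := fun s =>
    lintegral_inner_fderiv_supportPoint hM hX hd hp hv0 (y := e + s • u) (fun t => hz0 s t)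
  have hU : ∫⁻ t, ∫⁻ s, ENNReal.ofReal (q u s t * (1 + k * t ^ 2)⁻¹) =
      ENNReal.ofReal (inner ℝ (X u) u - inner ℝ (X (-u)) u) * I := by
    rw [hI, ← lintegral_const_mul' _ _ ENNReal.ofReal_ne_top]
    refine lintegral_congr fun t => ?_
    simp only [fun s => ENNReal.ofReal_mul (q := (1 + k * t ^ 2)⁻¹) (hq0 u s t)]
    rw [lintegral_mul_const' _ _ ENNReal.ofReal_ne_top, hku]
  have hV : ∫⁻ s, ∫⁻ t, ENNReal.ofReal (A * (q v s t * (1 + k * s ^ 2)⁻¹)) =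
      ENNReal.ofReal (A * (inner ℝ (X v) v - inner ℝ (X (-v)) v)) * I := by
    rw [hI, ← lintegral_const_mul' _ _ ENNReal.ofReal_ne_top]
    refine lintegral_congr fun s => ?_
    simp only [fun t => ENNReal.ofReal_mul (q := q v s t * (1 + k * s ^ 2)⁻¹) hA,
      fun t => ENNReal.ofReal_mul (q := (1 + k * s ^ 2)⁻¹) (hq0 v s t)]
    rw [lintegral_const_mul' _ _ ENNReal.ofReal_ne_top,
      lintegral_mul_const' _ _ ENNReal.ofReal_ne_top, hkv, ENNReal.ofReal_mul hA, mul_assoc]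
  have hswap : ∫⁻ s, ∫⁻ t, ENNReal.ofReal (A * (q v s t * (1 + k * s ^ 2)⁻¹)) =
      ∫⁻ t, ∫⁻ s, ENNReal.ofReal (A * (q v s t * (1 + k * s ^ 2)⁻¹)) := by
    refine lintegral_lintegral_swap (Measurable.aemeasurable ?_)
    have := hqm v
    simp only [Function.uncurry_def]
    fun_prop
  have hle : ENNReal.ofReal (inner ℝ (X u) u - inner ℝ (X (-u)) u) * I ≤
      ENNReal.ofReal (A * (inner ℝ (X v) v - inner ℝ (X (-v)) v)) * I := by
    rw [← hU, ← hV, hswap]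
    exact lintegral_mono fun t => lintegral_mono fun s => ENNReal.ofReal_le_ofReal (hcomp s t)
  have hle' := (ENNReal.mul_le_mul_iff_left hI0 hI1).1 hle
  have hw : 0 ≤ inner ℝ (X v) v - inner ℝ (X (-v)) v :=
    sub_nonneg.2 ((hX v hv0).le _ (hX _ (neg_ne_zero.2 hv0)).mem)
  exact (ENNReal.ofReal_le_ofReal_iff (mul_nonneg hA hw)).1 hle'

theorem width_le_mul_width {C : Set E} {X : E → E} {M A : ℝ} (hA : 1 ≤ A)
    (hdim : 3 ≤ Module.finrank ℝ E)
    (hM : ∀ x ∈ C, ‖x‖ ≤ M) (hX : ∀ u, u ≠ 0 → IsSupportPoint C u (X u))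
    (hd : ∀ u, u ≠ 0 → DifferentiableAt ℝ X u)
    (hp : ∀ z, z ≠ 0 → ∀ η, 0 ≤ inner ℝ (fderiv ℝ X z η) η)
    (hpinch : ∀ z, z ≠ 0 → ∀ η ζ,
      inner ℝ (fderiv ℝ X z η) η * (‖ζ‖ ^ 2 * ‖z‖ ^ 2 - inner ℝ ζ z ^ 2) ≤
        A * (inner ℝ (fderiv ℝ X z ζ) ζ * (‖η‖ ^ 2 * ‖z‖ ^ 2 - inner ℝ η z ^ 2)))
    {u v : E} (hu : ‖u‖ = 1) (hv : ‖v‖ = 1) :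
    inner ℝ (X u) u - inner ℝ (X (-u)) u ≤ A * (inner ℝ (X v) v - inner ℝ (X (-v)) v) := by
  have hv0 : v ≠ 0 := by rintro rfl; simp at hv
  have hw : 0 ≤ inner ℝ (X v) v - inner ℝ (X (-v)) v :=
    sub_nonneg.2 ((hX v hv0).le _ (hX _ (neg_ne_zero.2 hv0)).mem)
  have habs : |inner ℝ u v| ≤ 1 := by simpa [hu, hv] using abs_real_inner_le_norm u v
  rcases habs.lt_or_eq with h | h
  · have hlt : Module.finrank ℝ (Submodule.span ℝ {u, v}) < Module.finrank ℝ E := by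
      classical
      have := finrank_span_finset_le_card (R := ℝ) ({u, v} : Finset E)
      have h2 := Finset.card_le_two (a := u) (b := v)
      simp only [Finset.coe_insert, Finset.coe_singleton] at this
      change Module.finrank ℝ (Submodule.span ℝ {u, v}) ≤ _ at this
      omega
    have hne : (Submodule.span ℝ {u, v})ᗮ ≠ ⊥ := by
      intro h
      rw [Submodule.orthogonal_eq_bot_iff] at h
      rw [h, finrank_top] at hlt
      exact lt_irrefl _ hlt
    obtain ⟨e, he, he0⟩ := Submodule.exists_mem_ne_zero_of_ne_bot hne
    have h1 : inner ℝ e u = 0 := Submodule.inner_left_of_mem_orthogonal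
      (Submodule.subset_span (by simp)) he
    have h2 : inner ℝ e v = 0 := Submodule.inner_left_of_mem_orthogonal
      (Submodule.subset_span (by simp)) he
    refine width_le_mul_width_of_linearIndependent (e := ‖e‖⁻¹ • e) (by linarith) hM hX hd hp
      hpinch ?_ hu hv ?_ ?_ ?_
    · rw [norm_smul, norm_inv, norm_norm, inv_mul_cancel₀ (norm_ne_zero_iff.2 he0)]
    · simp [inner_smul_left, h1]
    · simp [inner_smul_left, h2]
    · rw [← sq_abs]
      have := abs_nonneg (inner ℝ u v)
      nlinarith
  · have : u = v ∨ u = -v := by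
      rcases eq_or_eq_neg_of_abs_eq h with h | h
      · left
        exact (inner_eq_one_iff_of_norm_eq_one (𝕜 := ℝ) hu hv).1 h
      · right
        rw [← inner_eq_one_iff_of_norm_eq_one (𝕜 := ℝ) hu (by simpa using hv), inner_neg_right, h,
          neg_neg]
    rcases this with rfl | rfl
    · nlinarith
    · simp only [neg_neg, inner_neg_right]
      nlinarith

end Width

/-! ### The inradius of a convex body in terms of its minimal width -/

section Inradius

variable {E : Type*} [NormedAddCommGroup E] [InnerProductSpace ℝ E] [FiniteDimensional ℝ E]

/-- Minkowski's bound on the asymmetry of a convex body, by Helly's theorem: for a suitable centre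
`z`, the reflected body `z - (C - z)` is contained in the homothetic image `z + d (C - z)`. -/
theorem exists_asymmetry_center {C : Set E} (hC : IsCompact C) (hconv : Convex ℝ C)
    (hne : C.Nonempty) (hdim : 0 < Module.finrank ℝ E) :
    ∃ z, ∀ x ∈ C, ∃ y ∈ C,
      ((Module.finrank ℝ E : ℝ) + 1) • z = x + (Module.finrank ℝ E : ℝ) • y := by
  set d := Module.finrank ℝ E with hd
  have hd0 : (0 : ℝ) < d := by exact_mod_cast hdim
  have hd1 : (0 : ℝ) < d + 1 := by positivity
  classical
  have : Nonempty C := hne.to_subtype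
  -- The second factor of the index type only serves to make it infinite.
  let F : C × ℕ → Set E := fun i =>
    (fun y => ((d : ℝ) + 1)⁻¹ • ((i.1 : E) + (d : ℝ) • y)) '' C
  have hF : ∀ i, F i = AffineMap.homothety (i.1 : E) ((d : ℝ) / (d + 1)) '' C := by
    intro i
    refine image_congr fun y _ => ?_
    rw [AffineMap.homothety_apply, vsub_eq_sub, vadd_eq_add]
    have : (i.1 : E) = ((d : ℝ) + 1)⁻¹ • ((d : ℝ) + 1) • (i.1 : E) := by
      rw [smul_smul, inv_mul_cancel₀ hd1.ne', one_smul]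
    have e : ((d : ℝ) / (d + 1)) • (y - (i.1 : E)) + (i.1 : E)
        = ((d : ℝ) / (d + 1)) • y + (1 - (d : ℝ) / (d + 1)) • (i.1 : E) := by module
    rw [e, smul_add, smul_smul, add_comm]
    congr 2
    · field_simp
    · field_simp; ring
  obtain ⟨z, hz⟩ := Convex.helly_theorem_compact (𝕜 := ℝ) (F := F) (by simp)
    (fun i => by rw [hF]; exact hconv.affine_image _)
    (fun i => hC.image (by fun_prop)) (fun I hI => by
      refine ⟨((d : ℝ) + 1)⁻¹ • ∑ i ∈ I, (i.1 : E), mem_iInter₂.2 fun j hj => ?_⟩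
      refine ⟨∑ i ∈ I.erase j, (d : ℝ)⁻¹ • (i.1 : E), hconv.sum_mem ?_ ?_ ?_, ?_⟩
      · intro i _; positivity
      · rw [Finset.sum_const, Finset.card_erase_of_mem hj, hI]
        simp [← hd, hd0.ne']
      · intro i _; exact i.1.2
      · simp only
        rw [← Finset.smul_sum, smul_smul, mul_inv_cancel₀ hd0.ne', one_smul,
          Finset.add_sum_erase I (fun i => (i.1 : E)) hj])
  refine ⟨z, fun x hx => ?_⟩
  obtain ⟨y, hy, hyz⟩ := mem_iInter.1 hz (⟨x, hx⟩, 0)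
  refine ⟨y, hy, ?_⟩
  rw [← hyz, smul_smul, mul_inv_cancel₀ hd1.ne', one_smul]

open scoped Pointwise in
theorem closedBall_subset_sub {C : Set E} (hC : IsCompact C) (hconv : Convex ℝ C)
    (hne : C.Nonempty) {w : ℝ}
    (hw : ∀ u : E, ‖u‖ = 1 → ∃ a ∈ C, ∃ b ∈ C, w ≤ inner ℝ a u - inner ℝ b u)
    {p : E} (hp : ‖p‖ ≤ w) : ∃ a ∈ C, ∃ b ∈ C, p = a - b := by
  by_contra hcon
  have hpD : p ∉ C - C := by
    rintro ⟨a, ha, b, hb, h⟩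
    exact hcon ⟨a, ha, b, hb, h.symm⟩
  obtain ⟨f, s, hf, hs⟩ := geometric_hahn_banach_closed_point (hconv.sub hconv)
    (by rw [sub_eq_add_neg]; exact (hC.add hC.neg).isClosed) hpD
  obtain ⟨g, rfl⟩ := (InnerProductSpace.toDual ℝ E).surjective f
  simp only [InnerProductSpace.toDual_apply_apply] at hf hs
  have hs0 : 0 < s := by
    obtain ⟨x, hx⟩ := hne
    simpa using hf (x - x) (Set.sub_mem_sub hx hx)
  have hg : 0 < ‖g‖ := by
    rw [norm_pos_iff]
    rintro rfl
    simp at hs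
    linarith
  obtain ⟨a, ha, b, hb, hab⟩ := hw (‖g‖⁻¹ • g) (by
    rw [norm_smul, norm_inv, norm_norm, inv_mul_cancel₀ hg.ne'])
  have h1 := hf (a - b) (Set.sub_mem_sub ha hb)
  have h2 := real_inner_le_norm g p
  rw [← inner_sub_left, inner_smul_right, real_inner_comm] at hab
  have h3 : ‖g‖ * w ≤ inner ℝ g (a - b) := by
    have := mul_le_mul_of_nonneg_left hab hg.le
    rwa [mul_inv_cancel_left₀ hg.ne'] at this
  nlinarith

/-- A convex body of dimension `d` all of whose widths are at least `w` contains a ball of radius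
`w / (d + 1)`. -/
theorem exists_closedBall_subset_of_width {C : Set E} (hC : IsCompact C) (hconv : Convex ℝ C)
    (hne : C.Nonempty) (hdim : 0 < Module.finrank ℝ E) {w : ℝ}
    (hw : ∀ u : E, ‖u‖ = 1 → ∃ a ∈ C, ∃ b ∈ C, w ≤ inner ℝ a u - inner ℝ b u) :
    ∃ z, Metric.closedBall z (w / ((Module.finrank ℝ E : ℝ) + 1)) ⊆ C := by
  obtain ⟨z, hz⟩ := exists_asymmetry_center hC hconv hne hdim
  set d := Module.finrank ℝ E with hd
  have hd1 : (0 : ℝ) < d + 1 := by positivity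
  refine ⟨z, fun x hx => ?_⟩
  rw [mem_closedBall_iff_norm, le_div_iff₀ hd1] at hx
  obtain ⟨a, ha, b, hb, hab⟩ := closedBall_subset_sub hC hconv hne hw
    (p := ((d : ℝ) + 1) • (x - z)) (by
      rw [norm_smul, Real.norm_of_nonneg hd1.le, mul_comm]; exact hx)
  obtain ⟨y, hy, hyz⟩ := hz b hb
  have h1 : ((d : ℝ) + 1) • x = a + (d : ℝ) • y := by
    rw [smul_sub, hyz] at hab
    rw [sub_eq_iff_eq_add.1 hab]
    abel
  have h2 : x = ((d : ℝ) + 1)⁻¹ • a + ((d : ℝ) / (d + 1)) • y := by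
    have := congrArg (fun v => ((d : ℝ) + 1)⁻¹ • v) h1
    simp only [smul_smul, smul_add] at this
    rw [inv_mul_cancel₀ hd1.ne', one_smul] at this
    rw [this]
    congr 2
    field_simp
  rw [h2]
  refine hconv ha hy (by positivity) (by positivity) ?_
  field_simp
  ring

end Inradius

/-! ### Regularity of the inverse Gauss map -/

section GaussMap

variable {E : Type*} [NormedAddCommGroup E] [InnerProductSpace ℝ E]

/-- Near the boundary point `x` of the convex body `C`, the field `ν` is normal to the boundary
`{F = 0}` of `C` (not necessarily of unit length), and the second fundamental form
`⟪D_ξ ν, ξ⟫` at `x` is positive and pinched with ratio `A`. Boundary points are described as support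
points of `C`. -/
structure IsPinchedNormalAt (C : Set E) (A : ℝ) (x : E) (ν : E → E) (F : E → ℝ) : Prop where
  contDiffAt_normal : ContDiffAt ℝ 1 ν x
  contDiffAt_def : ContDiffAt ℝ 1 F x
  fderiv_eq : ∃ k : ℝ, k ≠ 0 ∧ ∀ ξ, fderiv ℝ F x ξ = k * inner ℝ (ν x) ξ
  normal : ∀ᶠ y in 𝓝 x, ∀ u, u ≠ 0 → IsSupportPoint C u y → F y = 0 ∧ ∃ s : ℝ, 0 < s ∧ s • ν y = u
  symm : ∀ ξ ζ, inner ℝ (ν x) ξ = 0 → inner ℝ (ν x) ζ = 0 →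
    inner ℝ (fderiv ℝ ν x ξ) ζ = inner ℝ (fderiv ℝ ν x ζ) ξ
  pinched : ∃ m : ℝ, 0 < m ∧ ∀ ξ, inner ℝ (ν x) ξ = 0 →
    m * ‖ξ‖ ^ 2 ≤ inner ℝ (fderiv ℝ ν x ξ) ξ ∧ inner ℝ (fderiv ℝ ν x ξ) ξ ≤ A * (m * ‖ξ‖ ^ 2)

/-- The inverse of a positive pinched form on the hyperplane `z^⊥` is pinched with the same ratio:
if `⟪B ξ, ξ⟫` lies between `m ‖ξ‖²` and `A m ‖ξ‖²` and `B ξ = η` modulo `z`, then `⟪ξ, η⟫` lies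
between `‖η'‖² / (A m)` and `‖η'‖² / m`, where `η'` is the projection of `η` to `z^⊥`. -/
theorem inner_bounds_of_pinched {B : E →L[ℝ] E} {z : E} (hz : z ≠ 0) {m A : ℝ} (hm : 0 < m)
    (hsymm : ∀ ξ ζ, inner ℝ z ξ = 0 → inner ℝ z ζ = 0 → inner ℝ (B ξ) ζ = inner ℝ (B ζ) ξ)
    (hB : ∀ ξ, inner ℝ z ξ = 0 →
      m * ‖ξ‖ ^ 2 ≤ inner ℝ (B ξ) ξ ∧ inner ℝ (B ξ) ξ ≤ A * (m * ‖ξ‖ ^ 2))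
    {ξ η : E} {τ : ℝ} (hξ : inner ℝ z ξ = 0) (hη : B ξ + τ • z = η) :
    0 ≤ inner ℝ ξ η ∧
    m * inner ℝ ξ η * ‖z‖ ^ 2 ≤ ‖η‖ ^ 2 * ‖z‖ ^ 2 - inner ℝ η z ^ 2 ∧
    ‖η‖ ^ 2 * ‖z‖ ^ 2 - inner ℝ η z ^ 2 ≤ A * (m * inner ℝ ξ η * ‖z‖ ^ 2) := by
  have hz2 : 0 < ‖z‖ ^ 2 := by positivity
  have hzz : inner ℝ z z = ‖z‖ ^ 2 := real_inner_self_eq_norm_sq z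
  have hξz : inner ℝ ξ z = 0 := by rw [real_inner_comm]; exact hξ
  have hb : inner ℝ ξ η = inner ℝ (B ξ) ξ := by
    rw [← hη, inner_add_right, inner_smul_right, hξz, mul_zero, add_zero, real_inner_comm]
  set a : ℝ := inner ℝ ξ η with ha
  have ha0 : m * ‖ξ‖ ^ 2 ≤ a := by rw [hb]; exact (hB ξ hξ).1
  have ha1 : 0 ≤ a := le_trans (by positivity) ha0
  set η' : E := η - (inner ℝ η z / ‖z‖ ^ 2) • z with hη'
  have h1 : inner ℝ z η' = 0 := by
    rw [hη', inner_sub_right, inner_smul_right, hzz, real_inner_comm]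
    field_simp
    ring
  have h1' : inner ℝ η' z = 0 := by rw [real_inner_comm]; exact h1
  have hηη' : inner ℝ η η' = ‖η'‖ ^ 2 := by
    have : η = η' + (inner ℝ η z / ‖z‖ ^ 2) • z := by rw [hη']; abel
    nth_rewrite 1 [this]
    rw [inner_add_left, inner_smul_left, h1, real_inner_self_eq_norm_sq]
    simp
  have h2 : ‖η‖ ^ 2 * ‖z‖ ^ 2 - inner ℝ η z ^ 2 = ‖η'‖ ^ 2 * ‖z‖ ^ 2 := by
    have : inner ℝ η η' = ‖η‖ ^ 2 - inner ℝ η z / ‖z‖ ^ 2 * inner ℝ η z := by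
      rw [hη', inner_sub_right, inner_smul_right, real_inner_self_eq_norm_sq]
    rw [← hηη', this]
    field_simp
  have h3 : m * a ≤ ‖η'‖ ^ 2 := by
    have e1 : a = inner ℝ ξ η' := by
      rw [hη', inner_sub_right, inner_smul_right, hξz, mul_zero, sub_zero]
    have e2 : a ^ 2 ≤ ‖ξ‖ ^ 2 * ‖η'‖ ^ 2 := by
      rw [e1, ← mul_pow, ← sq_abs]
      exact pow_le_pow_left₀ (abs_nonneg _) (abs_real_inner_le_norm _ _) 2
    rcases ha1.eq_or_lt with h | h
    · rw [← h]; simp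
    · have e3 : m * a ^ 2 ≤ a * ‖η'‖ ^ 2 := by
        nlinarith [mul_le_mul_of_nonneg_right ha0 (sq_nonneg ‖η'‖)]
      have e4 : a * (m * a) ≤ a * ‖η'‖ ^ 2 := by nlinarith
      exact le_of_mul_le_mul_left e4 h
  have h4 : ‖η'‖ ^ 2 ≤ A * (m * a) := by
    by_cases h0 : η' = 0
    · have := hB ξ hξ
      rw [h0]
      rw [← hb] at this
      have hA : 0 ≤ A ∨ ‖ξ‖ ^ 2 = 0 := by
        by_contra! hcon
        have : 0 < ‖ξ‖ ^ 2 := lt_of_le_of_ne (sq_nonneg _) (Ne.symm hcon.2)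
        nlinarith [mul_pos hm this]
      rcases hA with hA | hA
      · simp; positivity
      · rw [hA] at this
        have : a = 0 := by linarith
        simp [this]
    · have hp : 0 < ‖η'‖ ^ 2 := by positivity
      have hβ : inner ℝ (B ξ) η' = ‖η'‖ ^ 2 := by
        rw [← hηη', ← hη, inner_add_left, inner_smul_left, h1]
        simp
      obtain ⟨g0, g1⟩ := hB η' h1
      set γ : ℝ := inner ℝ (B η') η' with hγ
      have hγ0 : 0 < γ := lt_of_lt_of_le (by positivity) g0
      -- the Cauchy-Schwarz inequality for the form `B`
      have hcs := (hB (γ • ξ - ‖η'‖ ^ 2 • η') (by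
        rw [inner_sub_right, inner_smul_right, inner_smul_right, hξ, h1]; simp)).1
      have hs := hsymm ξ η' hξ h1
      rw [hβ] at hs
      have e : inner ℝ (B (γ • ξ - ‖η'‖ ^ 2 • η')) (γ • ξ - ‖η'‖ ^ 2 • η')
          = γ * (γ * a - (‖η'‖ ^ 2) ^ 2) := by
        simp only [map_sub, map_smul, inner_sub_left, inner_sub_right, inner_smul_left,
          inner_smul_right, hβ, ← hs, ← hb, ← hγ]
        simp
        ring
      rw [e] at hcs
      have h5 : 0 ≤ γ * a - (‖η'‖ ^ 2) ^ 2 :=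
        nonneg_of_mul_nonneg_right (le_trans (by positivity) hcs) hγ0
      have h6 : ‖η'‖ ^ 2 * ‖η'‖ ^ 2 ≤ ‖η'‖ ^ 2 * (A * (m * a)) := by
        nlinarith [mul_le_mul_of_nonneg_right g1 ha1]
      exact le_of_mul_le_mul_left h6 hp
  rw [h2]
  refine ⟨ha1, by nlinarith, by nlinarith⟩

variable [FiniteDimensional ℝ E]

/-- The inverse function theorem for `(y, s) ↦ (s ν(y), F(y))`: near a support point `x` for `u`,
the support point is a differentiable function of the direction. -/
theorem IsPinchedNormalAt.exists_local_inverse {C : Set E} {A : ℝ} {x u : E} {ν : E → E}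
    {F : E → ℝ} (h : IsPinchedNormalAt C A x ν F) (hu : u ≠ 0) (hx : IsSupportPoint C u x) :
    ∃ (ι : E → E) (L : E →L[ℝ] E), HasFDerivAt ι L u ∧
      (∀ᶠ p : E × E in 𝓝 (x, u), IsSupportPoint C p.2 p.1 → ι p.2 = p.1) ∧
      ∃ m : ℝ, 0 < m ∧ ∀ η, 0 ≤ inner ℝ (L η) η ∧
        m * inner ℝ (L η) η * ‖u‖ ^ 2 ≤ ‖η‖ ^ 2 * ‖u‖ ^ 2 - inner ℝ η u ^ 2 ∧
        ‖η‖ ^ 2 * ‖u‖ ^ 2 - inner ℝ η u ^ 2 ≤ A * (m * inner ℝ (L η) η * ‖u‖ ^ 2) := by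
  obtain ⟨hFx, s₀, hs₀, hs₀u⟩ := h.normal.self_of_nhds u hu hx
  obtain ⟨k, hk, hkF⟩ := h.fderiv_eq
  obtain ⟨m, hm, hmB⟩ := h.pinched
  have hνx : ν x ≠ 0 := by
    intro h0; rw [h0, smul_zero] at hs₀u; exact hu hs₀u.symm
  have hνu : ∀ ξ, inner ℝ u ξ = s₀ * inner ℝ (ν x) ξ := fun ξ => by
    rw [← hs₀u, inner_smul_left]; simp
  have hperp : ∀ ξ, inner ℝ u ξ = 0 → inner ℝ (ν x) ξ = 0 := fun ξ hξ => by
    rw [hνu] at hξ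
    exact (mul_eq_zero.1 hξ).resolve_left hs₀.ne'
  let B : E →L[ℝ] E := s₀ • fderiv ℝ ν x
  have hBi : ∀ ξ ζ, inner ℝ (B ξ) ζ = s₀ * inner ℝ (fderiv ℝ ν x ξ) ζ := fun ξ ζ => by
    simp only [B, smul_apply, inner_smul_left]; simp
  have hBsymm : ∀ ξ ζ, inner ℝ u ξ = 0 → inner ℝ u ζ = 0 →
      inner ℝ (B ξ) ζ = inner ℝ (B ζ) ξ := fun ξ ζ h1 h2 => by
    rw [hBi, hBi, h.symm ξ ζ (hperp ξ h1) (hperp ζ h2)]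
  have hBpinch : ∀ ξ, inner ℝ u ξ = 0 → (s₀ * m) * ‖ξ‖ ^ 2 ≤ inner ℝ (B ξ) ξ ∧
      inner ℝ (B ξ) ξ ≤ A * ((s₀ * m) * ‖ξ‖ ^ 2) := fun ξ h1 => by
    obtain ⟨a1, a2⟩ := hmB ξ (hperp ξ h1)
    rw [hBi]
    constructor <;> nlinarith
  -- `F` fixes the position across the boundary, and `s` absorbs the length of the normal field.
  let Φ : E × ℝ → E × ℝ := fun p => (p.2 • ν p.1, F p.1)
  have hΦ : ContDiffAt ℝ 1 Φ (x, s₀) := by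
    have h1 : ContDiffAt ℝ 1 (fun p : E × ℝ => ν p.1) (x, s₀) :=
      ContDiffAt.comp (x, s₀) (g := ν) h.contDiffAt_normal contDiffAt_fst
    have h2 : ContDiffAt ℝ 1 (fun p : E × ℝ => F p.1) (x, s₀) :=
      ContDiffAt.comp (x, s₀) (g := F) h.contDiffAt_def contDiffAt_fst
    exact (contDiffAt_snd.smul h1).prodMk h2
  have hΦ' : ∀ (ξ : E) (σ : ℝ), fderiv ℝ Φ (x, s₀) (ξ, σ)
      = (B ξ + σ • ν x, k * inner ℝ (ν x) ξ) := by
    intro ξ σ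
    have h1 : HasFDerivAt (fun p : E × ℝ => ν p.1)
        ((fderiv ℝ ν x).comp (ContinuousLinearMap.fst ℝ E ℝ)) (x, s₀) :=
      HasFDerivAt.comp (x, s₀) (g := ν)
        (h.contDiffAt_normal.differentiableAt (by norm_num)).hasFDerivAt hasFDerivAt_fst
    have h2 : HasFDerivAt (fun p : E × ℝ => F p.1)
        ((fderiv ℝ F x).comp (ContinuousLinearMap.fst ℝ E ℝ)) (x, s₀) :=
      HasFDerivAt.comp (x, s₀) (g := F)
        (h.contDiffAt_def.differentiableAt (by norm_num)).hasFDerivAt hasFDerivAt_fst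
    have h3 : HasFDerivAt (fun p : E × ℝ => p.2) (ContinuousLinearMap.snd ℝ E ℝ) (x, s₀) :=
      hasFDerivAt_snd
    have h4 := (h3.smul h1).prodMk h2
    rw [HasFDerivAt.fderiv (f := Φ) h4]
    simp [B, hkF]
  have hinj : Function.Injective (fderiv ℝ Φ (x, s₀)) := by
    rw [injective_iff_map_eq_zero]
    rintro ⟨ξ, σ⟩ h0
    rw [hΦ', Prod.mk_eq_zero] at h0
    have h1 : inner ℝ (ν x) ξ = 0 := (mul_eq_zero.1 h0.2).resolve_left hk
    have h2 : inner ℝ u ξ = 0 := by rw [hνu, h1, mul_zero]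
    have h3 : inner ℝ (B ξ) ξ = 0 := by
      have := congrArg (fun v => inner ℝ v ξ) h0.1
      simpa [inner_add_left, inner_smul_left, h1] using this
    have h4 := (hBpinch ξ h2).1
    rw [h3] at h4
    have hξ0 : ξ = 0 := by
      by_contra hne
      have : 0 < (s₀ * m) * ‖ξ‖ ^ 2 := by positivity
      linarith
    have h5 := h0.1
    rw [hξ0, map_zero, zero_add] at h5
    rw [hξ0, (smul_eq_zero.1 h5).resolve_right hνx]
    rfl
  let e : (E × ℝ) ≃L[ℝ] (E × ℝ) :=
    (LinearEquiv.ofInjectiveEndo (fderiv ℝ Φ (x, s₀)).toLinearMap hinj).toContinuousLinearEquiv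
  have he : ∀ p, e p = fderiv ℝ Φ (x, s₀) p := fun p => rfl
  have hstrict : HasStrictFDerivAt Φ (e : E × ℝ →L[ℝ] E × ℝ) (x, s₀) := by
    have hE : (e : E × ℝ →L[ℝ] E × ℝ) = fderiv ℝ Φ (x, s₀) := ContinuousLinearMap.ext fun p => rfl
    rw [hE]
    exact hΦ.hasStrictFDerivAt (by norm_num)
  have hΦx : Φ (x, s₀) = (u, 0) := by simp [Φ, hs₀u, hFx]
  let ι : E → E := fun v => (hstrict.localInverse Φ e (x, s₀) (v, 0)).1
  let L : E →L[ℝ] E := (ContinuousLinearMap.fst ℝ E ℝ).comp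
    ((e.symm : E × ℝ →L[ℝ] E × ℝ).comp (ContinuousLinearMap.inl ℝ E ℝ))
  have hι : HasFDerivAt ι L u := by
    have h1 : HasFDerivAt (hstrict.localInverse Φ e (x, s₀))
        (e.symm : E × ℝ →L[ℝ] E × ℝ) (u, 0) := by
      rw [← hΦx]; exact hstrict.to_localInverse.hasFDerivAt
    have h2 : HasFDerivAt (fun v : E => (v, (0 : ℝ))) (ContinuousLinearMap.inl ℝ E ℝ) u :=
      (ContinuousLinearMap.inl ℝ E ℝ).hasFDerivAt
    exact hasFDerivAt_fst.comp u (HasFDerivAt.comp u h1 h2)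
  refine ⟨ι, L, hι, ?_, s₀ * m, by positivity, fun η => ?_⟩
  · have hcont : ContinuousAt (fun p : E × E => (p.1, ‖p.2‖ / ‖ν p.1‖)) (x, u) := by
      have h1 : ContinuousAt (fun p : E × E => ν p.1) (x, u) :=
        ContinuousAt.comp (g := ν) h.contDiffAt_normal.continuousAt continuousAt_fst
      exact continuousAt_fst.prodMk
        (continuousAt_snd.norm.div h1.norm (norm_ne_zero_iff.2 hνx))
    have hval : (fun p : E × E => (p.1, ‖p.2‖ / ‖ν p.1‖)) (x, u) = (x, s₀) := by
      simp only [← hs₀u, norm_smul, Real.norm_of_nonneg hs₀.le]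
      rw [mul_div_cancel_right₀ _ (norm_ne_zero_iff.2 hνx)]
    have hleft := hstrict.eventually_left_inverse
    unfold ContinuousAt at hcont
    rw [hval] at hcont
    have hev := hcont.eventually hleft
    have hn : ∀ᶠ p : E × E in 𝓝 (x, u), _ :=
      (continuousAt_fst (p := (x, u))).eventually h.normal
    have hne : ∀ᶠ p : E × E in 𝓝 (x, u), p.2 ≠ 0 :=
      (continuousAt_snd (p := (x, u))).eventually_ne hu
    filter_upwards [hev, hn, hne] with p h1 h2 h3 hp
    obtain ⟨h4, s, hs, hsp⟩ := h2 p.2 h3 hp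
    have hνp : ‖ν p.1‖ ≠ 0 := by
      intro h0
      rw [norm_eq_zero.1 h0, smul_zero] at hsp
      exact h3 hsp.symm
    have hss : ‖p.2‖ / ‖ν p.1‖ = s := by
      rw [← hsp, norm_smul, Real.norm_of_nonneg hs.le, mul_div_cancel_right₀ _ hνp]
    rw [hss] at h1
    have : Φ (p.1, s) = (p.2, 0) := by simp [Φ, hsp, h4]
    rw [this] at h1
    simp only [ι, h1]
  · obtain ⟨⟨ξ, σ⟩, hp⟩ : ∃ p, e.symm (η, 0) = p := ⟨_, rfl⟩
    have hLη : L η = ξ := by simp [L, hp]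
    have hep : e (ξ, σ) = (η, 0) := by rw [← hp]; simp
    rw [he, hΦ', Prod.mk.injEq] at hep
    have h1 : inner ℝ (ν x) ξ = 0 := (mul_eq_zero.1 hep.2).resolve_left hk
    rw [hLη]
    refine inner_bounds_of_pinched (τ := σ / s₀) hu (by positivity) hBsymm hBpinch
      (by rw [hνu, h1, mul_zero]) ?_
    rw [← hep.1, ← hs₀u, smul_smul, div_mul_cancel₀ _ hs₀.ne']

/-- A convex body with positive and pinched second fundamental form has a unique support point in
each direction, and this inverse of the Gauss map is differentiable with pinched differential. -/
theorem exists_supportPoint_differentiable {C : Set E} {A : ℝ} (hC : IsCompact C)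
    (hconv : Convex ℝ C) (hne : C.Nonempty)
    (hν : ∀ u x, u ≠ 0 → IsSupportPoint C u x → ∃ ν F, IsPinchedNormalAt C A x ν F) :
    ∃ X : E → E, (∀ u, u ≠ 0 → IsSupportPoint C u (X u)) ∧
      (∀ u, u ≠ 0 → DifferentiableAt ℝ X u) ∧
      (∀ z, z ≠ 0 → ∀ η, 0 ≤ inner ℝ (fderiv ℝ X z η) η) ∧
      (∀ z, z ≠ 0 → ∀ η ζ,
        inner ℝ (fderiv ℝ X z η) η * (‖ζ‖ ^ 2 * ‖z‖ ^ 2 - inner ℝ ζ z ^ 2) ≤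
          A * (inner ℝ (fderiv ℝ X z ζ) ζ * (‖η‖ ^ 2 * ‖z‖ ^ 2 - inner ℝ η z ^ 2))) := by
  have hex : ∀ u : E, ∃ x, IsSupportPoint C u x := by
    intro u
    obtain ⟨x, hx, hmax⟩ := hC.exists_isMaxOn hne
      (f := fun y => inner ℝ y u) (by fun_prop)
    exact ⟨x, hx, fun y hy => hmax hy⟩
  choose X hX using hex
  have huniq : ∀ u x y, u ≠ 0 → IsSupportPoint C u x → IsSupportPoint C u y → y = x := by
    intro u x y hu hx hy
    obtain ⟨ν, F, hνF⟩ := hν u x hu hx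
    obtain ⟨ι, L, -, hι, -⟩ := hνF.exists_local_inverse hu hx
    by_contra hxy
    have hseg : ∀ t : ℝ, 0 ≤ t → t ≤ 1 → IsSupportPoint C u (x + t • (y - x)) := by
      intro t h0 h1
      refine ⟨hconv.add_smul_sub_mem hx.mem hy.mem ⟨h0, h1⟩, fun w hw => ?_⟩
      rw [inner_add_left, inner_smul_left, inner_sub_left]
      have := hx.le _ hy.mem
      have := hy.le _ hx.mem
      have : inner ℝ y u - inner ℝ x u = 0 := by linarith
      rw [this, mul_zero, add_zero]
      exact hx.le w hw
    have hc : Tendsto (fun t : ℝ => (x + t • (y - x), u)) (𝓝[>] 0) (𝓝 (x, u)) := by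
      have : Continuous (fun t : ℝ => (x + t • (y - x), u)) := by fun_prop
      have := this.tendsto 0
      simp only [zero_smul, add_zero] at this
      exact this.mono_left nhdsWithin_le_nhds
    have hle1 : ∀ᶠ t : ℝ in 𝓝[>] 0, t ≤ 1 :=
      (eventually_le_nhds (by norm_num : (0 : ℝ) < 1)).filter_mono nhdsWithin_le_nhds
    obtain ⟨t, ht, ht1, ht0⟩ :=
      ((hc.eventually hι).and (hle1.and self_mem_nhdsWithin)).exists
    have h1 := ht (hseg t (le_of_lt ht0) ht1)
    have h2 := hι.self_of_nhds hx
    simp only at h1 h2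
    rw [h2] at h1
    have h3 : t • (y - x) = 0 := by simpa using h1
    rcases smul_eq_zero.1 h3 with h4 | h4
    · exact (ne_of_gt ht0) h4
    · exact hxy (sub_eq_zero.1 h4)
  have hcont : ∀ u, u ≠ 0 → ContinuousAt X u := by
    intro u hu
    refine hC.tendsto_nhds_of_unique_mapClusterPt (Eventually.of_forall fun v => (hX v).mem) ?_
    intro x hx hcl
    refine huniq u (X u) x hu (hX u) ⟨hx, fun y hy => ?_⟩
    obtain ⟨U, hU, hUx⟩ := mapClusterPt_iff_ultrafilter.1 hcl
    exact le_of_tendsto_of_tendsto (tendsto_const_nhds.inner hU) (hUx.inner hU)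
      (Eventually.of_forall fun v => (hX v).le y hy)
  have hder : ∀ u, u ≠ 0 → ∃ L : E →L[ℝ] E, HasFDerivAt X L u ∧
      ∃ m : ℝ, 0 < m ∧ ∀ η, 0 ≤ inner ℝ (L η) η ∧
        m * inner ℝ (L η) η * ‖u‖ ^ 2 ≤ ‖η‖ ^ 2 * ‖u‖ ^ 2 - inner ℝ η u ^ 2 ∧
        ‖η‖ ^ 2 * ‖u‖ ^ 2 - inner ℝ η u ^ 2 ≤ A * (m * inner ℝ (L η) η * ‖u‖ ^ 2) := by
    intro u hu
    obtain ⟨ν, F, hνF⟩ := hν u (X u) hu (hX u)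
    obtain ⟨ι, L, hL, hι, hm⟩ := hνF.exists_local_inverse hu (hX u)
    refine ⟨L, hL.congr_of_eventuallyEq ?_, hm⟩
    have hc : Tendsto (fun v => (X v, v)) (𝓝 u) (𝓝 (X u, u)) :=
      (hcont u hu).prodMk continuousAt_id
    filter_upwards [hc.eventually hι] with v hv
    exact (hv (hX v)).symm
  refine ⟨X, fun u _ => hX u, fun u hu => ?_, fun u hu η => ?_, fun u hu η ζ => ?_⟩
  · obtain ⟨L, hL, -⟩ := hder u hu
    exact hL.differentiableAt
  · obtain ⟨L, hL, m, hm, h⟩ := hder u hu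
    rw [hL.fderiv]
    exact (h η).1
  · obtain ⟨L, hL, m, hm, h⟩ := hder u hu
    rw [hL.fderiv]
    obtain ⟨a0, a1, -⟩ := h η
    obtain ⟨b0, -, b2⟩ := h ζ
    set a := inner ℝ (L η) η
    set b := inner ℝ (L ζ) ζ
    have hu2 : 0 < m * ‖u‖ ^ 2 := by positivity
    have hP : 0 ≤ ‖η‖ ^ 2 * ‖u‖ ^ 2 - inner ℝ η u ^ 2 := le_trans (by positivity) a1
    have hQ : 0 ≤ A * (m * b * ‖u‖ ^ 2) := by
      refine le_trans ?_ b2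
      have := abs_real_inner_le_norm ζ u
      rw [← sq_abs (inner ℝ ζ u), ← mul_pow]
      exact sub_nonneg.2 (pow_le_pow_left₀ (abs_nonneg _) this 2)
    have h1 := mul_le_mul_of_nonneg_left b2 (by positivity : 0 ≤ m * a * ‖u‖ ^ 2)
    have h2 := mul_le_mul_of_nonneg_right a1 hQ
    refine le_of_mul_le_mul_left (le_trans (le_trans (le_of_eq ?_) (h1.trans h2)) (le_of_eq ?_)) hu2
    · ring
    · ring

end GaussMap

/-! ### Support points on a smooth boundary -/

/-- The Lagrange multiplier rule at a support point of a set that is locally `{F ≤ 0}`. -/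
theorem IsSupportPoint.exists_smul_eq {E : Type*} [NormedAddCommGroup E] [InnerProductSpace ℝ E]
    {C : Set E} {u y ν : E} (h : IsSupportPoint C u y) (hu : u ≠ 0) {F : E → ℝ}
    (hF : DifferentiableAt ℝ F y) {k : ℝ} (hk : 0 < k) (hν : ν ≠ 0)
    (hFν : ∀ ξ, fderiv ℝ F y ξ = k * inner ℝ ν ξ) (hC : ∀ᶠ z in 𝓝 y, z ∈ C ↔ F z ≤ 0) :
    F y = 0 ∧ ∃ s : ℝ, 0 < s ∧ s • ν = u := by
  have hline : ∀ ξ : E, Tendsto (fun t : ℝ => y + t • ξ) (𝓝[>] 0) (𝓝 y) := by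
    intro ξ
    have : Continuous (fun t : ℝ => y + t • ξ) := by fun_prop
    have := this.tendsto 0
    simp only [zero_smul, add_zero] at this
    exact this.mono_left nhdsWithin_le_nhds
  -- a direction that leads into `C` for small times has nonpositive product with `u`
  have hdir : ∀ ξ : E, (∀ᶠ t : ℝ in 𝓝[>] 0, F (y + t • ξ) ≤ 0) → inner ℝ ξ u ≤ 0 := by
    intro ξ hξ
    obtain ⟨t, ⟨h1, h2⟩, h3⟩ := ((hξ.and ((hline ξ).eventually hC)).and self_mem_nhdsWithin).exists
    have h4 := h.le _ (h2.2 h1)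
    rw [inner_add_left, inner_smul_left] at h4
    have h5 : t * inner ℝ ξ u ≤ 0 := by simpa using h4
    by_contra! hcon
    have := mul_pos (show (0 : ℝ) < t from h3) hcon
    linarith
  have hF0 : F y = 0 := by
    refine le_antisymm (hC.self_of_nhds.1 h.mem) ?_
    by_contra! hlt
    have h1 := hdir u (((hline u).eventually
      (hF.continuousAt.eventually_lt continuousAt_const hlt)).mono fun t ht => le_of_lt ht)
    rw [real_inner_self_eq_norm_sq] at h1
    have : 0 < ‖u‖ ^ 2 := by positivity
    linarith
  refine ⟨hF0, ?_⟩
  have hneg : ∀ ξ, inner ℝ ν ξ < 0 → inner ℝ ξ u ≤ 0 := by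
    intro ξ hξ
    refine hdir ξ ?_
    have hd : HasDerivAt (fun t : ℝ => F (y + t • ξ)) (k * inner ℝ ν ξ) 0 := by
      have h1 : HasDerivAt (fun t : ℝ => y + t • ξ) ξ 0 := by
        simpa using ((hasDerivAt_id (0 : ℝ)).smul_const ξ).const_add y
      have h2 : HasFDerivAt F (fderiv ℝ F y) (y + (0 : ℝ) • ξ) := by
        simpa using hF.hasFDerivAt
      have := h2.comp_hasDerivAt (0 : ℝ) h1
      rwa [hFν] at this
    have hlt : k * inner ℝ ν ξ < 0 := mul_neg_of_pos_of_neg hk hξ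
    have hs := (hasDerivAt_iff_tendsto_slope.1 hd).eventually (eventually_lt_nhds hlt)
    have hs' := hs.filter_mono (nhdsWithin_mono (0 : ℝ) (s := Ioi 0) fun t ht => ne_of_gt ht)
    filter_upwards [hs', self_mem_nhdsWithin] with t h1 h2
    rw [slope_def_field] at h1
    simp only [zero_smul, add_zero, hF0, sub_zero] at h1
    by_contra! hcon
    have : 0 < F (y + t • ξ) / t := div_pos hcon h2
    linarith
  have hνν : 0 < inner ℝ ν ν := by
    rw [real_inner_self_eq_norm_sq]; positivity
  set s : ℝ := inner ℝ ν u / inner ℝ ν ν with hs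
  have horth : inner ℝ ν (u - s • ν) = 0 := by
    rw [inner_sub_right, inner_smul_right, hs, div_mul_cancel₀ _ hνν.ne', sub_self]
  have hlim : inner ℝ (u - s • ν) u ≤ 0 := by
    have hc : Tendsto (fun t : ℝ => inner ℝ (u - s • ν - t • ν) u) (𝓝[>] 0)
        (𝓝 (inner ℝ (u - s • ν) u)) := by
      have : Continuous (fun t : ℝ => inner ℝ (u - s • ν - t • ν) u) := by fun_prop
      have := this.tendsto 0
      simp only [zero_smul, sub_zero] at this
      exact this.mono_left nhdsWithin_le_nhds
    refine le_of_tendsto hc ?_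
    filter_upwards [self_mem_nhdsWithin] with t ht
    refine hneg _ ?_
    rw [inner_sub_right, horth, inner_smul_right]
    have := mul_pos (show (0 : ℝ) < t from ht) hνν
    linarith
  have hzero : u - s • ν = 0 := by
    have h1 : inner ℝ (u - s • ν) u = ‖u - s • ν‖ ^ 2 := by
      rw [← real_inner_self_eq_norm_sq]
      conv_rhs => rw [inner_sub_right, inner_smul_right, real_inner_comm ν, horth,
        mul_zero, sub_zero]
    rw [h1] at hlim
    have := sq_nonneg ‖u - s • ν‖
    have h2 : ‖u - s • ν‖ ^ 2 = 0 := le_antisymm hlim this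
    simpa using h2
  have hus : s • ν = u := (sub_eq_zero.1 hzero).symm
  refine ⟨s, ?_, hus⟩
  have h1 := hneg (-ν) (by rw [inner_neg_right]; linarith)
  rw [inner_neg_left] at h1
  have h2 : 0 ≤ s := div_nonneg (by linarith) hνν.le
  rcases h2.eq_or_lt with h3 | h3
  · rw [← h3, zero_smul] at hus
    exact absurd hus.symm hu
  · exact h3

theorem IsSupportPoint.notMem_nhds {E : Type*} [NormedAddCommGroup E] [InnerProductSpace ℝ E]
    {C : Set E} {u x : E} (h : IsSupportPoint C u x) (hu : u ≠ 0) : C ∉ 𝓝 x := by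
  intro hC
  have hline : Tendsto (fun t : ℝ => x + t • u) (𝓝[>] 0) (𝓝 x) := by
    have : Continuous (fun t : ℝ => x + t • u) := by fun_prop
    have := this.tendsto 0
    simp only [zero_smul, add_zero] at this
    exact this.mono_left nhdsWithin_le_nhds
  obtain ⟨t, h1, h2⟩ := ((hline.eventually hC).and self_mem_nhdsWithin).exists
  have h3 := h.le _ h1
  rw [inner_add_left, inner_smul_left, real_inner_self_eq_norm_sq] at h3
  have h4 : 0 < t * ‖u‖ ^ 2 := mul_pos h2 (by positivity)
  have h5 : t * ‖u‖ ^ 2 ≤ 0 := by simpa using h3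
  linarith

noncomputable section

namespace Hyp

variable {m : ℕ}

/-! ### Minkowski space and orthonormal frames -/

/-- The Minkowski form as a continuous bilinear map. -/
def formL (m : ℕ) : Mink m →L[ℝ] Mink m →L[ℝ] ℝ :=
  (isBoundedBilinearMap_inner (𝕜 := ℝ)).toContinuousLinearMap.bilinearComp
      (ContinuousLinearMap.snd ℝ ℝ (EuclideanSpace ℝ (Fin m)))
      (ContinuousLinearMap.snd ℝ ℝ (EuclideanSpace ℝ (Fin m))) -
    (ContinuousLinearMap.mul ℝ ℝ).bilinearComp
      (ContinuousLinearMap.fst ℝ ℝ (EuclideanSpace ℝ (Fin m)))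
      (ContinuousLinearMap.fst ℝ ℝ (EuclideanSpace ℝ (Fin m)))

theorem formL_apply (u v : Mink m) : formL m u v = form u v := rfl

theorem form_comm (u v : Mink m) : form u v = form v u := by
  simp only [form, real_inner_comm, mul_comm]

theorem form_add_left (u v w : Mink m) : form (u + v) w = form u w + form v w := by
  simp only [← formL_apply, map_add, add_apply]

theorem form_add_right (u v w : Mink m) : form u (v + w) = form u v + form u w := by
  simp only [← formL_apply, map_add]

theorem form_sub_right (u v w : Mink m) : form u (v - w) = form u v - form u w := by
  simp only [← formL_apply, map_sub]

theorem form_sub_left (u v w : Mink m) : form (u - v) w = form u w - form v w := by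
  simp only [← formL_apply, map_sub, sub_apply]

theorem form_smul_left (a : ℝ) (u v : Mink m) : form (a • u) v = a * form u v := by
  simp only [← formL_apply, map_smul, smul_apply, smul_eq_mul]

theorem form_smul_right (a : ℝ) (u v : Mink m) : form u (a • v) = a * form u v := by
  simp only [← formL_apply, map_smul, smul_eq_mul]

theorem continuous_form {X : Type*} [TopologicalSpace X] {f g : X → Mink m} (hf : Continuous f)
    (hg : Continuous g) : Continuous fun x => form (f x) (g x) := by
  unfold form
  fun_prop

/-- The reversed Cauchy-Schwarz inequality for unit timelike vectors. -/
theorem form_le_neg_one (p q : HSpace m) : form p.1 q.1 ≤ -1 := by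
  obtain ⟨⟨t, x⟩, hp, hp0⟩ := p
  obtain ⟨⟨s, y⟩, hq, hq0⟩ := q
  change inner ℝ x x - t * t = -1 at hp
  change inner ℝ y y - s * s = -1 at hq
  change 0 < t at hp0
  change 0 < s at hq0
  change inner ℝ x y - t * s ≤ -1
  rw [real_inner_self_eq_norm_sq] at hp hq
  have h := real_inner_le_norm x y
  have h1 : ‖x‖ ^ 2 = t ^ 2 - 1 := by linarith
  have h2 : ‖y‖ ^ 2 = s ^ 2 - 1 := by linarith
  have h3 : ‖x‖ * ‖y‖ ≤ t * s - 1 := by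
    refine (abs_le_of_sq_le_sq' ?_ ?_).2
    · rw [mul_pow, h1, h2]; nlinarith [sq_nonneg (t - s)]
    · have a1 : 1 ≤ t := by nlinarith [sq_nonneg ‖x‖]
      have a2 : 1 ≤ s := by nlinarith [sq_nonneg ‖y‖]
      nlinarith
  linarith

/-- For `c ∈ ℍ^m`, the restriction to `ℝ^m = (1, 0)^⊥` of the Lorentz boost that carries `(1, 0)`
to `c`. It is an isometry onto the orthogonal complement of `c`. -/
def frame (c : Mink m) : EuclideanSpace ℝ (Fin m) →L[ℝ] Mink m :=
  (innerSL ℝ c.2).prod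
    (ContinuousLinearMap.id ℝ _ + (1 + c.1)⁻¹ • (innerSL ℝ c.2).smulRight c.2)

/-- The adjoint of `frame c`. -/
def coframe (c : Mink m) : Mink m →L[ℝ] EuclideanSpace ℝ (Fin m) :=
  ContinuousLinearMap.snd ℝ ℝ _ +
    ((1 + c.1)⁻¹ • (innerSL ℝ c.2).comp (ContinuousLinearMap.snd ℝ ℝ _) -
      ContinuousLinearMap.fst ℝ ℝ _).smulRight c.2

theorem frame_apply (c : Mink m) (x : EuclideanSpace ℝ (Fin m)) :
    frame c x = (inner ℝ c.2 x, x + ((1 + c.1)⁻¹ * inner ℝ c.2 x) • c.2) := by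
  simp [frame, smul_smul]

theorem coframe_apply (c Z : Mink m) :
    coframe c Z = Z.2 + ((1 + c.1)⁻¹ * inner ℝ c.2 Z.2 - Z.1) • c.2 := by
  simp [coframe]

theorem form_frame (c Z : Mink m) (x : EuclideanSpace ℝ (Fin m)) :
    form Z (frame c x) = inner ℝ (coframe c Z) x := by
  rw [frame_apply, coframe_apply]
  simp only [form, inner_add_left, inner_add_right, inner_smul_left, inner_smul_right]
  simp only [real_inner_comm c.2]
  simp
  ring

theorem HSpace.inner_self (c : HSpace m) : inner ℝ c.1.2 c.1.2 = c.1.1 ^ 2 - 1 := by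
  have := c.2.1
  simp only [form] at this
  linarith

theorem coframe_self (c : HSpace m) : coframe c.1 c.1 = 0 := by
  have h0 : (1 + c.1.1) ≠ 0 := by linarith [c.2.2]
  rw [coframe_apply, c.inner_self]
  have : (1 + c.1.1)⁻¹ * (c.1.1 ^ 2 - 1) - c.1.1 = -1 := by field_simp; ring
  rw [this]
  simp

theorem coframe_frame (c : HSpace m) (x : EuclideanSpace ℝ (Fin m)) :
    coframe c.1 (frame c.1 x) = x := by
  have h0 : (1 + c.1.1) ≠ 0 := by linarith [c.2.2]
  rw [coframe_apply, frame_apply]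
  simp only [inner_add_right, inner_smul_right, c.inner_self]
  rw [add_assoc, ← add_smul]
  have : (1 + c.1.1)⁻¹ * inner ℝ c.1.2 x + ((1 + c.1.1)⁻¹ * (inner ℝ c.1.2 x +
      (1 + c.1.1)⁻¹ * inner ℝ c.1.2 x * (c.1.1 ^ 2 - 1)) - inner ℝ c.1.2 x) = 0 := by
    field_simp; ring
  rw [this]
  simp

theorem form_frame_frame (c : HSpace m) (x y : EuclideanSpace ℝ (Fin m)) :
    form (frame c.1 x) (frame c.1 y) = inner ℝ x y := by
  rw [form_frame, coframe_frame]

theorem form_self_frame (c : HSpace m) (x : EuclideanSpace ℝ (Fin m)) :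
    form c.1 (frame c.1 x) = 0 := by
  rw [form_frame, coframe_self, inner_zero_left]

/-- The orthogonal decomposition of Minkowski space along `c` and `c^⊥`. -/
theorem eq_smul_add_frame (c : HSpace m) (Z : Mink m) :
    Z = (-form c.1 Z) • c.1 + frame c.1 (coframe c.1 Z) := by
  have h0 : (1 + c.1.1) ≠ 0 := by linarith [c.2.2]
  have hi : inner ℝ c.1.2 (coframe c.1 Z) = c.1.1 * inner ℝ c.1.2 Z.2 - Z.1 * (c.1.1 ^ 2 - 1) := by
    rw [coframe_apply, inner_add_right, inner_smul_right, c.inner_self]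
    field_simp
    ring
  rw [frame_apply, hi, coframe_apply]
  refine Prod.ext ?_ ?_
  · simp only [Prod.fst_add, Prod.smul_fst, smul_eq_mul, form]
    ring
  · simp only [Prod.snd_add, Prod.smul_snd, form]
    rw [add_assoc, ← add_smul, add_left_comm, ← add_smul, left_eq_add]
    convert zero_smul ℝ c.1.2 using 2
    field_simp
    ring

theorem eq_frame_of_form_eq_zero (c : HSpace m) {Z : Mink m} (h : form c.1 Z = 0) :
    Z = frame c.1 (coframe c.1 Z) := by
  conv_lhs => rw [eq_smul_add_frame c Z, h]
  simp

theorem form_self_of_tangent (c : HSpace m) {Z : Mink m} (h : form c.1 Z = 0) :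
    form Z Z = ‖coframe c.1 Z‖ ^ 2 := by
  rw [eq_frame_of_form_eq_zero c h, form_frame_frame, coframe_frame, real_inner_self_eq_norm_sq]

theorem form_self_pos_of_tangent (c : HSpace m) {Z : Mink m} (h : form c.1 Z = 0) (hZ : Z ≠ 0) :
    0 < form Z Z := by
  rw [form_self_of_tangent c h]
  have : coframe c.1 Z ≠ 0 := by
    intro h0
    apply hZ
    rw [eq_frame_of_form_eq_zero c h, h0, map_zero]
  positivity

theorem HSpace.ext_of_form_eq {p q : HSpace m} (h : form p.1 q.1 = -1) : q = p := by
  have h1 := eq_smul_add_frame p q.1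
  have h2 : form q.1 q.1 = -1 := q.2.1
  rw [h] at h1
  have h3 : form p.1 (q.1 - p.1) = 0 := by rw [form_sub_right, h, p.2.1]; ring
  have h4 : form (q.1 - p.1) (q.1 - p.1) = 0 := by
    rw [form_sub_left, h3, form_sub_right, h2, form_comm, h]; ring
  by_contra hne
  have := form_self_pos_of_tangent p h3 (sub_ne_zero.2 fun h => hne (Subtype.ext h))
  linarith

/-! ### The Klein model -/

/-- The vector of Minkowski space above the point `x` of the Klein model centred at `c`. -/
def kleinLift (c : Mink m) (x : EuclideanSpace ℝ (Fin m)) : Mink m := c + frame c x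

theorem form_kleinLift (c : HSpace m) (x y : EuclideanSpace ℝ (Fin m)) :
    form (kleinLift c.1 x) (kleinLift c.1 y) = inner ℝ x y - 1 := by
  simp only [kleinLift, form_add_left, form_add_right, form_frame_frame, form_self_frame, c.2.1,
    form_comm (frame c.1 x) c.1]
  ring

theorem kleinLift_fst_pos (c : HSpace m) {x : EuclideanSpace ℝ (Fin m)} (hx : ‖x‖ < 1) :
    0 < (kleinLift c.1 x).1 := by
  have h1 : (kleinLift c.1 x).1 = c.1.1 + inner ℝ c.1.2 x := by simp [kleinLift, frame_apply]
  rw [h1]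
  have h2 := (abs_le.1 (abs_real_inner_le_norm c.1.2 x)).1
  have h3 : ‖c.1.2‖ < c.1.1 := by
    refine lt_of_pow_lt_pow_left₀ 2 c.2.2.le ?_
    rw [← real_inner_self_eq_norm_sq, c.inner_self]
    linarith
  nlinarith [norm_nonneg c.1.2, norm_nonneg x]

/-- The inverse of the Klein chart centred at `c`, as a vector of Minkowski space. -/
def kleinMink (c : Mink m) (x : EuclideanSpace ℝ (Fin m)) : Mink m :=
  (Real.sqrt (1 - ‖x‖ ^ 2))⁻¹ • kleinLift c x

theorem one_sub_norm_sq_pos {E : Type*} [NormedAddCommGroup E] {x : E} (hx : ‖x‖ < 1) :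
    0 < 1 - ‖x‖ ^ 2 := by
  nlinarith [norm_nonneg x]

theorem kleinMink_mem (c : HSpace m) {x : EuclideanSpace ℝ (Fin m)} (hx : ‖x‖ < 1) :
    form (kleinMink c.1 x) (kleinMink c.1 x) = -1 ∧ 0 < (kleinMink c.1 x).1 := by
  have h := one_sub_norm_sq_pos hx
  refine ⟨?_, ?_⟩
  · rw [kleinMink, form_smul_left, form_smul_right, form_kleinLift, real_inner_self_eq_norm_sq,
      ← mul_assoc, ← mul_inv, Real.mul_self_sqrt h.le]
    field_simp
    ring
  · have := kleinLift_fst_pos c hx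
    have h2 := Real.sqrt_pos.2 h
    simp only [kleinMink, Prod.smul_fst, smul_eq_mul]
    positivity

open Classical in
/-- The inverse of the Klein chart centred at `c`, a map from the open unit ball to `ℍ^m` (with the
arbitrary value `c` outside of the ball). -/
def klein (c : HSpace m) (x : EuclideanSpace ℝ (Fin m)) : HSpace m :=
  if hx : ‖x‖ < 1 then ⟨kleinMink c.1 x, kleinMink_mem c hx⟩ else c

theorem klein_val (c : HSpace m) {x : EuclideanSpace ℝ (Fin m)} (hx : ‖x‖ < 1) :
    (klein c x).1 = kleinMink c.1 x := by
  rw [klein, dif_pos hx]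

/-- The Klein chart centred at `c`: the central projection of `ℍ^m` to the affine hyperplane
`c + c^⊥`. -/
def kleinCoord (c q : HSpace m) : EuclideanSpace ℝ (Fin m) :=
  (-form c.1 q.1)⁻¹ • coframe c.1 q.1

theorem one_le_neg_form (c q : HSpace m) : 1 ≤ -form c.1 q.1 := by
  linarith [form_le_neg_one c q]

theorem kleinLift_kleinCoord (c q : HSpace m) :
    kleinLift c.1 (kleinCoord c q) = (-form c.1 q.1)⁻¹ • q.1 := by
  have h := one_le_neg_form c q
  have h1 := congrArg (fun v => (-form c.1 q.1)⁻¹ • v) (eq_smul_add_frame c q.1)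
  simp only [smul_add, smul_smul] at h1
  rw [h1, kleinLift, kleinCoord, inv_mul_cancel₀ (by linarith), one_smul, map_smul]

theorem one_sub_norm_kleinCoord_sq (c q : HSpace m) :
    1 - ‖kleinCoord c q‖ ^ 2 = ((-form c.1 q.1)⁻¹) ^ 2 := by
  have h := form_kleinLift c (kleinCoord c q) (kleinCoord c q)
  rw [kleinLift_kleinCoord, form_smul_left, form_smul_right, q.2.1,
    real_inner_self_eq_norm_sq] at h
  linarith

theorem norm_kleinCoord_lt (c q : HSpace m) : ‖kleinCoord c q‖ < 1 := by
  have h := one_le_neg_form c q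
  have h1 := one_sub_norm_kleinCoord_sq c q
  have h2 : 0 < ((-form c.1 q.1)⁻¹) ^ 2 := by positivity
  refine lt_of_pow_lt_pow_left₀ 2 zero_le_one ?_
  linarith

theorem klein_kleinCoord (c q : HSpace m) : klein c (kleinCoord c q) = q := by
  have h := one_le_neg_form c q
  apply Subtype.ext
  rw [klein_val c (norm_kleinCoord_lt c q), kleinMink, one_sub_norm_kleinCoord_sq,
    Real.sqrt_sq (by positivity), inv_inv, kleinLift_kleinCoord, smul_smul,
    mul_inv_cancel₀ (by linarith), one_smul]

theorem kleinCoord_klein (c : HSpace m) {x : EuclideanSpace ℝ (Fin m)} (hx : ‖x‖ < 1) :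
    kleinCoord c (klein c x) = x := by
  have h := Real.sqrt_pos.2 (one_sub_norm_sq_pos hx)
  rw [kleinCoord, klein_val c hx, kleinMink, form_smul_right, map_smul, kleinLift, form_add_right,
    form_self_frame, map_add, coframe_self, coframe_frame, c.2.1, smul_smul]
  have : (-((Real.sqrt (1 - ‖x‖ ^ 2))⁻¹ * (-1 + 0)))⁻¹ * (Real.sqrt (1 - ‖x‖ ^ 2))⁻¹ = 1 := by
    field_simp
    norm_num
  rw [this, zero_add, one_smul]

theorem continuous_kleinCoord (c : HSpace m) : Continuous (kleinCoord c) := by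
  unfold kleinCoord
  have h1 : Continuous fun q : HSpace m => -form c.1 q.1 :=
    (continuous_form continuous_const continuous_subtype_val).neg
  exact (h1.inv₀ fun q => by linarith [one_le_neg_form c q]).smul
    ((coframe c.1).continuous.comp continuous_subtype_val)

theorem contDiffAt_kleinMink (c : Mink m) {x : EuclideanSpace ℝ (Fin m)} (hx : ‖x‖ < 1) :
    ContDiffAt ℝ ∞ (kleinMink c) x := by
  have h := one_sub_norm_sq_pos hx
  have h1 : ContDiffAt ℝ ∞ (fun x : EuclideanSpace ℝ (Fin m) => 1 - ‖x‖ ^ 2) x :=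
    contDiffAt_const.sub (contDiff_norm_sq ℝ).contDiffAt
  have h2 : ContDiffAt ℝ ∞ (kleinLift c) x :=
    contDiffAt_const.add (frame c).contDiff.contDiffAt
  exact ((h1.sqrt h.ne').inv (Real.sqrt_pos.2 h).ne').smul h2

theorem eventually_norm_lt_one {E : Type*} [NormedAddCommGroup E] {x : E} (hx : ‖x‖ < 1) :
    ∀ᶠ y in 𝓝 x, ‖y‖ < 1 :=
  continuous_norm.continuousAt.eventually_lt continuousAt_const hx

theorem continuousAt_klein (c : HSpace m) {x : EuclideanSpace ℝ (Fin m)} (hx : ‖x‖ < 1) :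
    ContinuousAt (klein c) x := by
  refine tendsto_subtype_rng.2 ?_
  rw [klein_val c hx]
  refine Tendsto.congr' ?_ (contDiffAt_kleinMink c.1 hx).continuousAt.tendsto
  filter_upwards [eventually_norm_lt_one hx] with y hy
  exact (klein_val c hy).symm

theorem mem_image_kleinCoord {c : HSpace m} {K : Set (HSpace m)}
    {x : EuclideanSpace ℝ (Fin m)} : x ∈ kleinCoord c '' K ↔ ‖x‖ < 1 ∧ klein c x ∈ K := by
  constructor
  · rintro ⟨q, hq, rfl⟩
    exact ⟨norm_kleinCoord_lt c q, by rwa [klein_kleinCoord]⟩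
  · rintro ⟨hx, h⟩
    exact ⟨_, h, kleinCoord_klein c hx⟩

/-- A geodesically convex set contains every point of `ℍ^m` in the cone over two of its points. -/
theorem GeodesicallyConvex.mem_of_eq_add {K : Set (HSpace m)} (hK : GeodesicallyConvex K)
    {p q z : HSpace m} (hp : p ∈ K) (hq : q ∈ K) {a b : ℝ} (ha : 0 ≤ a) (hb : 0 ≤ b)
    (hz : z.1 = a • p.1 + b • q.1) : z ∈ K := by
  have hC1 := one_le_neg_form p q
  set C : ℝ := -form p.1 q.1 with hC
  have hpq : form p.1 q.1 = -C := by rw [hC, neg_neg]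
  have hqp : form q.1 p.1 = -C := by rw [form_comm, hpq]
  have hzz : a ^ 2 + b ^ 2 + 2 * a * b * C = 1 := by
    have := z.2.1
    rw [hz] at this
    simp only [form_add_left, form_add_right, form_smul_left, form_smul_right, p.2.1, q.2.1, hpq,
      hqp] at this
    linarith
  rcases hC1.eq_or_lt with h1 | h1
  · have hqp : q = p := HSpace.ext_of_form_eq (by rw [hpq, ← h1])
    have : z = p := HSpace.ext_of_form_eq (by
      rw [hz, form_add_right, form_smul_right, form_smul_right, hpq, p.2.1, ← h1]
      have : (a + b) ^ 2 = 1 := by rw [← h1] at hzz; linarith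
      have : a + b = 1 := by nlinarith
      linarith)
    rwa [this]
  · set S : ℝ := Real.sqrt (C ^ 2 - 1) with hS
    have hS2 : S ^ 2 = C ^ 2 - 1 := Real.sq_sqrt (by nlinarith)
    have hS0 : 0 < S := Real.sqrt_pos.2 (by nlinarith)
    have hsinh : Real.sinh (Real.arcosh C) = S := Real.sinh_arcosh hC1
    have hcosh : Real.cosh (Real.arcosh C) = C := Real.cosh_arcosh hC1
    have hcosht : Real.cosh (Real.arsinh (b * S)) = a + b * C := by
      have h2 := Real.cosh_sq (Real.arsinh (b * S))
      rw [Real.sinh_arsinh] at h2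
      refine (pow_left_inj₀ (Real.cosh_pos _).le (by positivity) two_ne_zero).1 ?_
      rw [h2, mul_pow, hS2]
      linarith
    have hsmul : S • S⁻¹ • (q.1 - C • p.1) = q.1 - C • p.1 := by
      rw [smul_smul, mul_inv_cancel₀ hS0.ne', one_smul]
    refine hK p q (S⁻¹ • (q.1 - C • p.1)) (Real.arcosh C) hp hq ?_ ?_ (Real.arcosh_nonneg hC1) ?_
      (Real.arsinh (b * S)) z (Real.arsinh_nonneg_iff.2 (by positivity)) ?_ ?_
    · rw [form_smul_right, form_sub_right, form_smul_right, hpq, p.2.1]; ring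
    · simp only [form_smul_right, form_smul_left, form_sub_right, form_sub_left, hpq, p.2.1, hqp,
        q.2.1]
      field_simp
      rw [hS2]
      ring
    · rw [geodesic, hsinh, hcosh, hsmul]
      abel
    · rw [← Real.sinh_le_sinh, Real.sinh_arsinh, hsinh]
      have : b ≤ 1 := by
        have : 0 ≤ a * b * C := by positivity
        nlinarith
      nlinarith
    · rw [geodesic, Real.sinh_arsinh, hcosht, hz, mul_smul b S, hsmul, add_smul, smul_sub, mul_smul]
      abel

theorem convex_image_kleinCoord {K : Set (HSpace m)} (hK : GeodesicallyConvex K) (c : HSpace m) :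
    Convex ℝ (kleinCoord c '' K) := by
  rintro _ ⟨p, hp, rfl⟩ _ ⟨q, hq, rfl⟩ s r hs hr hsr
  have hx : ‖s • kleinCoord c p + r • kleinCoord c q‖ < 1 := by
    have := (convex_ball (0 : EuclideanSpace ℝ (Fin m)) 1)
      (mem_ball_zero_iff.2 (norm_kleinCoord_lt c p)) (mem_ball_zero_iff.2 (norm_kleinCoord_lt c q))
      hs hr hsr
    exact mem_ball_zero_iff.1 this
  have h1 := one_le_neg_form c p
  have h2 := one_le_neg_form c q
  rw [mem_image_kleinCoord]
  refine ⟨hx, ?_⟩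
  set g := (Real.sqrt (1 - ‖s • kleinCoord c p + r • kleinCoord c q‖ ^ 2))⁻¹ with hg
  have hg0 : 0 ≤ g := inv_nonneg.2 (Real.sqrt_nonneg _)
  have hlift : kleinLift c.1 (s • kleinCoord c p + r • kleinCoord c q) =
      s • kleinLift c.1 (kleinCoord c p) + r • kleinLift c.1 (kleinCoord c q) := by
    simp only [kleinLift, map_add, map_smul, smul_add]
    have : c.1 = s • c.1 + r • c.1 := by rw [← add_smul, hsr, one_smul]
    nth_rewrite 1 [this]
    abel
  refine hK.mem_of_eq_add hp hq (a := g * (s * (-form c.1 p.1)⁻¹))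
    (b := g * (r * (-form c.1 q.1)⁻¹)) (by positivity) (by positivity) ?_
  rw [klein_val c hx, kleinMink, hlift, kleinLift_kleinCoord, kleinLift_kleinCoord]
  simp only [smul_add, smul_smul, ← hg]

/-! ### Balls and the outradius in the Klein model -/

theorem mem_geodesicBall {c q : HSpace m} {r : ℝ} (hr : 0 ≤ r) :
    q ∈ geodesicBall c r ↔ -form c.1 q.1 ≤ Real.cosh r := by
  have h := one_le_neg_form c q
  change Real.arcosh (-form c.1 q.1) ≤ r ↔ _
  rw [← Real.arcosh_le_arcosh (by linarith) (Real.cosh_pos r), Real.arcosh_cosh hr]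

theorem sinh_le_self_mul_cosh {h : ℝ} (hh : 0 ≤ h) : Real.sinh h ≤ h * Real.cosh h := by
  have hm : MonotoneOn (fun x : ℝ => x * Real.cosh x - Real.sinh x) (Ici 0) := by
    refine monotoneOn_of_deriv_nonneg (convex_Ici 0) (by fun_prop) (by fun_prop) fun x hx => ?_
    rw [interior_Ici] at hx
    have h1 : HasDerivAt (fun x : ℝ => x * Real.cosh x - Real.sinh x)
        (1 * Real.cosh x + x * Real.sinh x - Real.cosh x) x :=
      ((hasDerivAt_id x).mul (Real.hasDerivAt_cosh x)).sub (Real.hasDerivAt_sinh x)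
    rw [h1.deriv]
    have : 0 ≤ x * Real.sinh x := mul_nonneg (le_of_lt hx) (Real.sinh_nonneg_iff.2 (le_of_lt hx))
    linarith
  have := hm (mem_Ici.2 le_rfl) (mem_Ici.2 hh) hh
  simp only [zero_mul, Real.sinh_zero, sub_zero] at this
  linarith

theorem cosh_le_of_lt_two {δ : ℝ} (h0 : 0 ≤ δ) (h2 : δ < 2) :
    Real.cosh δ ≤ 1 + δ ^ 2 / 2 / (1 - δ ^ 2 / 4) := by
  have h1 := sinh_le_self_mul_cosh (h := δ / 2) (by positivity)
  have h3 := Real.cosh_sq (δ / 2)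
  have h4 : Real.cosh δ = 1 + 2 * Real.sinh (δ / 2) ^ 2 := by
    have := Real.cosh_two_mul (δ / 2)
    rw [mul_div_cancel₀ _ two_ne_zero] at this
    linarith
  have hpos : 0 < 1 - δ ^ 2 / 4 := by nlinarith
  have h5 : Real.sinh (δ / 2) ^ 2 ≤ (δ / 2 * Real.cosh (δ / 2)) ^ 2 :=
    pow_le_pow_left₀ (Real.sinh_nonneg_iff.2 (by positivity)) h1 2
  rw [mul_pow, h3] at h5
  have h6 : Real.sinh (δ / 2) ^ 2 ≤ δ ^ 2 / 4 / (1 - δ ^ 2 / 4) := by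
    rw [le_div_iff₀ hpos]; linarith
  have h7 : δ ^ 2 / 2 / (1 - δ ^ 2 / 4) = 2 * (δ ^ 2 / 4 / (1 - δ ^ 2 / 4)) := by ring
  rw [h4, h7]
  linarith

/-- The Klein chart does not increase distances. -/
theorem dist_kleinCoord_le_hdist (c p q : HSpace m) :
    dist (kleinCoord c p) (kleinCoord c q) ≤ hdist p q := by
  set x := kleinCoord c p with hx
  set y := kleinCoord c q with hy
  have hC := one_le_neg_form p q
  have ha := one_le_neg_form c p
  have hb := one_le_neg_form c q
  have hx1 := norm_kleinCoord_lt c p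
  have hy1 := norm_kleinCoord_lt c q
  have hxa := one_sub_norm_kleinCoord_sq c p
  have hyb := one_sub_norm_kleinCoord_sq c q
  have hxy := form_kleinLift c x y
  rw [hx, hy, kleinLift_kleinCoord, kleinLift_kleinCoord, form_smul_left, form_smul_right] at hxy
  rw [← hx] at hx1 hxa hxy
  rw [← hy] at hy1 hyb hxy
  set a := (-form c.1 p.1)⁻¹ with ha'
  set b := (-form c.1 q.1)⁻¹ with hb'
  have ha0 : 0 < a := by positivity
  have hb0 : 0 < b := by positivity
  rw [dist_eq_norm]
  set δ := ‖x - y‖ with hδ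
  have hδ2 : δ ^ 2 = ‖x‖ ^ 2 - 2 * inner ℝ x y + ‖y‖ ^ 2 := norm_sub_sq_real x y
  have hδ0 : 0 ≤ δ := norm_nonneg _
  have hδlt : δ < 2 := by have := norm_sub_le x y; linarith
  have hpar : δ ^ 2 ≤ 2 * (‖x‖ ^ 2 + ‖y‖ ^ 2) := by
    have := parallelogram_law_with_norm ℝ x y
    nlinarith [sq_nonneg ‖x + y‖]
  have hpos : 0 < 1 - δ ^ 2 / 4 := by nlinarith
  have key : Real.cosh δ ≤ -form p.1 q.1 := by
    refine (cosh_le_of_lt_two hδ0 hδlt).trans ?_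
    -- `δ² / 2 = a b (C - 1) - (a - b)² / 2`, where `C = cosh d(p, q)`
    have h1 : a * b * (-form p.1 q.1) = 1 - inner ℝ x y := by linarith
    have h2 : δ ^ 2 / 2 ≤ (-form p.1 q.1 - 1) * (1 - δ ^ 2 / 4) := by
      have h3 : (a ^ 2 + b ^ 2) / 2 ≤ 1 - δ ^ 2 / 4 := by rw [← hxa, ← hyb]; linarith
      have h4 : δ ^ 2 / 2 = a * b * (-form p.1 q.1 - 1) - (a - b) ^ 2 / 2 := by
        rw [mul_sub, h1, hδ2]
        nlinarith
      have h5 : a * b ≤ 1 - δ ^ 2 / 4 := by nlinarith [sq_nonneg (a - b)]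
      have h6 := mul_le_mul_of_nonneg_right h5 (by linarith : 0 ≤ -form p.1 q.1 - 1)
      nlinarith [sq_nonneg (a - b)]
    have := (div_le_iff₀ hpos).2 h2
    linarith
  rw [hdist, ← Real.arcosh_cosh hδ0,
    Real.arcosh_le_arcosh (by have := Real.cosh_pos δ; linarith) (by linarith)]
  exact key

theorem geodesicBall_klein_subset {c : HSpace m} {K : Set (HSpace m)}
    {z : EuclideanSpace ℝ (Fin m)} {r : ℝ} (hr : 0 ≤ r)
    (h : Metric.closedBall z r ⊆ kleinCoord c '' K) : geodesicBall (klein c z) r ⊆ K := by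
  intro q hq
  have hz : ‖z‖ < 1 := (mem_image_kleinCoord.1 (h (Metric.mem_closedBall_self hr))).1
  have h1 := dist_kleinCoord_le_hdist c (klein c z) q
  rw [kleinCoord_klein c hz, dist_comm] at h1
  have h2 := (mem_image_kleinCoord.1 (h (Metric.mem_closedBall.2 (h1.trans hq)))).2
  rwa [klein_kleinCoord] at h2

/-- In every direction `v` at the circumcentre there is a point of `K` on the circumscribed sphere
in the half space opposite to `v`: otherwise a small move of the centre along `v` would decrease the
radius. -/
theorem exists_contact_point {K : Set (HSpace m)} (hK : IsCompact K) (hne : K.Nonempty)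
    {c : HSpace m} {R : ℝ} (hR0 : 0 ≤ R) (hsub : K ⊆ geodesicBall c R)
    (hmin : ∀ (c' : HSpace m) (r : ℝ), 0 ≤ r → K ⊆ geodesicBall c' r → R ≤ r)
    {v : Mink m} (hv : form c.1 v = 0) (hvv : form v v = 1) :
    ∃ q ∈ K, -form c.1 q.1 = Real.cosh R ∧ form v q.1 ≤ 0 := by
  have hle : ∀ q ∈ K, -form c.1 q.1 ≤ Real.cosh R := fun q hq => (mem_geodesicBall hR0).1 (hsub hq)
  have step : ∀ ε : ℝ, 0 < ε → ∃ q ∈ K,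
      Real.cosh R ≤ Real.cosh ε * (-form c.1 q.1) - Real.sinh ε * form v q.1 := by
    intro ε hε
    have hc1 : form (geodesic c.1 v ε) (geodesic c.1 v ε) = -1 := by
      simp only [geodesic, form_add_left, form_add_right, form_smul_left, form_smul_right, hv, hvv,
        c.2.1, form_comm v c.1]
      have := Real.cosh_sq ε
      linarith
    have hc2 : 0 < (geodesic c.1 v ε).1 := by
      have hn : ‖coframe c.1 v‖ = 1 := by
        have := form_self_of_tangent c hv
        rw [hvv] at this
        nlinarith [norm_nonneg (coframe c.1 v)]
      have h1 := kleinLift_fst_pos c (x := Real.tanh ε • coframe c.1 v) (by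
        rw [norm_smul, hn, mul_one, Real.norm_eq_abs, abs_lt]
        exact ⟨Real.neg_one_lt_tanh ε, Real.tanh_lt_one ε⟩)
      have h2 : geodesic c.1 v ε = Real.cosh ε • kleinLift c.1 (Real.tanh ε • coframe c.1 v) := by
        rw [kleinLift, map_smul, ← eq_frame_of_form_eq_zero c hv, geodesic, smul_add, smul_smul,
          Real.tanh_eq_sinh_div_cosh, mul_div_cancel₀ _ (Real.cosh_pos ε).ne']
      rw [h2]
      exact mul_pos (Real.cosh_pos ε) h1
    obtain ⟨q, hq, hmax⟩ := hK.exists_isMaxOn hne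
      (f := fun q : HSpace m => -form (geodesic c.1 v ε) q.1)
      (continuous_form continuous_const continuous_subtype_val).neg.continuousOn
    refine ⟨q, hq, ?_⟩
    have h1 := one_le_neg_form ⟨geodesic c.1 v ε, hc1, hc2⟩ q
    have h2 := hmin ⟨geodesic c.1 v ε, hc1, hc2⟩ (Real.arcosh (-form (geodesic c.1 v ε) q.1))
      (Real.arcosh_nonneg h1) (fun p hp => by
        rw [mem_geodesicBall (Real.arcosh_nonneg h1), Real.cosh_arcosh h1]
        exact hmax hp)
    have h3 := Real.cosh_le_cosh.2 (abs_le_abs_of_nonneg hR0 h2)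
    rw [Real.cosh_arcosh h1] at h3
    simp only [geodesic, form_add_left, form_smul_left] at h3
    linarith
  have : Nonempty (HSpace m) := ⟨c⟩
  choose! Q hQK hQ using step
  let ε : ℕ → ℝ := fun k => 1 / ((k : ℝ) + 1)
  have hε0 : ∀ k, 0 < ε k := fun k => by positivity
  have hε : Tendsto ε atTop (𝓝 0) := tendsto_one_div_add_atTop_nhds_zero_nat
  obtain ⟨q, hq, φ, hφ, hlim⟩ := hK.tendsto_subseq (x := fun k => Q (ε k)) fun k => hQK _ (hε0 k)
  have hεφ : Tendsto (fun k => ε (φ k)) atTop (𝓝 0) := hε.comp hφ.tendsto_atTop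
  have hc : Tendsto (fun k => form c.1 (Q (ε (φ k))).1) atTop (𝓝 (form c.1 q.1)) :=
    ((continuous_form continuous_const continuous_subtype_val).tendsto q).comp hlim
  have hvl : Tendsto (fun k => form v (Q (ε (φ k))).1) atTop (𝓝 (form v q.1)) :=
    ((continuous_form continuous_const continuous_subtype_val).tendsto q).comp hlim
  have hcosh : Tendsto (fun k => Real.cosh (ε (φ k))) atTop (𝓝 1) := by
    have := (Real.continuous_cosh.tendsto 0).comp hεφ
    rwa [Real.cosh_zero] at this
  have hsinh : Tendsto (fun k => Real.sinh (ε (φ k))) atTop (𝓝 0) := by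
    have := (Real.continuous_sinh.tendsto 0).comp hεφ
    rwa [Real.sinh_zero] at this
  refine ⟨q, hq, le_antisymm (hle q hq) ?_, ?_⟩
  · have h1 := (hcosh.mul hc.neg).sub (hsinh.mul hvl)
    have h2 := ge_of_tendsto' h1 fun k => hQ _ (hε0 (φ k))
    linarith
  · have h1 : Tendsto (fun k => Real.cosh R * Real.sinh (ε (φ k))) atTop (𝓝 0) := by
      simpa using hsinh.const_mul (Real.cosh R)
    refine le_of_tendsto_of_tendsto' hvl h1 fun k => ?_
    have a1 := hQ _ (hε0 (φ k))
    have a2 := hle _ (hQK _ (hε0 (φ k)))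
    have a3 : 0 < Real.sinh (ε (φ k)) := Real.sinh_pos_iff.2 (hε0 _)
    have a4 := Real.cosh_sq (ε (φ k))
    have a5 := Real.one_le_cosh (ε (φ k))
    have a6 := Real.one_le_cosh R
    have a7 := mul_le_mul_of_nonneg_left a2 (Real.cosh_pos (ε (φ k))).le
    -- `cosh ε - 1 ≤ sinh² ε`
    have a8 : Real.cosh (ε (φ k)) - 1 ≤ Real.sinh (ε (φ k)) ^ 2 := by nlinarith
    have a9 := mul_le_mul_of_nonneg_left a8 (Real.cosh_pos R).le
    refine le_of_mul_le_mul_left (a := Real.sinh (ε (φ k))) ?_ a3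
    nlinarith

theorem norm_kleinCoord_sq_eq {c q : HSpace m} {R : ℝ} (h : -form c.1 q.1 = Real.cosh R) :
    ‖kleinCoord c q‖ ^ 2 = Real.tanh R ^ 2 := by
  have h1 := one_sub_norm_kleinCoord_sq c q
  rw [h] at h1
  have h2 := Real.cosh_sq R
  have h3 := Real.cosh_pos R
  rw [Real.tanh_eq_sinh_div_cosh, div_pow, eq_div_iff (by positivity)]
  have h4 : ((Real.cosh R)⁻¹) ^ 2 * Real.cosh R ^ 2 = 1 := by
    rw [← mul_pow, inv_mul_cancel₀ h3.ne', one_pow]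
  have h5 : ‖kleinCoord c q‖ ^ 2 = 1 - ((Real.cosh R)⁻¹) ^ 2 := by linarith
  rw [h5, sub_mul, h4, h2]
  ring

/-- Two points of `K` on the circumscribed sphere which are seen from the circumcentre under an
angle of at least `π / 2`. -/
theorem exists_far_points (hm : 0 < m) {K : Set (HSpace m)} (hK : IsCompact K) (hne : K.Nonempty)
    {c : HSpace m} {R : ℝ} (hR0 : 0 ≤ R) (hsub : K ⊆ geodesicBall c R)
    (hmin : ∀ (c' : HSpace m) (r : ℝ), 0 ≤ r → K ⊆ geodesicBall c' r → R ≤ r) :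
    ∃ x ∈ kleinCoord c '' K, ∃ y ∈ kleinCoord c '' K, Real.sqrt 2 * Real.tanh R ≤ ‖x - y‖ := by
  have key : ∀ u : EuclideanSpace ℝ (Fin m), ‖u‖ = 1 → ∃ x ∈ kleinCoord c '' K,
      ‖x‖ ^ 2 = Real.tanh R ^ 2 ∧ inner ℝ x u ≤ 0 := by
    intro u hu
    obtain ⟨q, hq, h1, h2⟩ := exists_contact_point hK hne hR0 hsub hmin (form_self_frame c u)
      (by rw [form_frame_frame, real_inner_self_eq_norm_sq, hu, one_pow])
    refine ⟨_, ⟨q, hq, rfl⟩, norm_kleinCoord_sq_eq h1, ?_⟩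
    rw [form_comm, form_frame] at h2
    have := one_le_neg_form c q
    rw [kleinCoord, inner_smul_left]
    exact mul_nonpos_of_nonneg_of_nonpos (by simp only [conj_trivial]; positivity) h2
  have ht : 0 ≤ Real.tanh R := by
    rw [Real.tanh_eq_sinh_div_cosh]
    exact div_nonneg (Real.sinh_nonneg_iff.2 hR0) (Real.cosh_pos R).le
  obtain ⟨x, hx, hxn, -⟩ := key (EuclideanSpace.single ⟨0, hm⟩ 1) (by simp)
  have hxR : ‖x‖ = Real.tanh R := (pow_left_inj₀ (norm_nonneg x) ht two_ne_zero).1 hxn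
  rcases ht.eq_or_lt with h0 | h0
  · exact ⟨x, hx, x, hx, by rw [← h0]; simp⟩
  · have hx0 : ‖x‖ ≠ 0 := by rw [hxR]; exact h0.ne'
    obtain ⟨y, hy, hyn, hyx⟩ := key (‖x‖⁻¹ • x) (by
      rw [norm_smul, norm_inv, norm_norm, inv_mul_cancel₀ hx0])
    refine ⟨x, hx, y, hy, ?_⟩
    rw [inner_smul_right] at hyx
    have hyx' : inner ℝ y x ≤ 0 := by
      by_contra! hcon
      have : 0 < ‖x‖⁻¹ * inner ℝ y x := by positivity
      linarith
    have h1 := norm_sub_sq_real x y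
    rw [real_inner_comm] at h1
    refine le_of_sq_le_sq ?_ (norm_nonneg _)
    rw [mul_pow, Real.sq_sqrt zero_le_two, h1, hxn, hyn]
    linarith

/-! ### The shape operator -/

theorem contDiffAt_form {E : Type*} [NormedAddCommGroup E] [NormedSpace ℝ E] {k : WithTop ℕ∞}
    {f g : E → Mink m} {x : E} (hf : ContDiffAt ℝ k f x) (hg : ContDiffAt ℝ k g x) :
    ContDiffAt ℝ k (fun x => form (f x) (g x)) x :=
  ((formL m).contDiff.contDiffAt.comp x hf).clm_apply hg

theorem hasFDerivAt_form {E : Type*} [NormedAddCommGroup E] [NormedSpace ℝ E]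
    {f g : E → Mink m} {f' g' : E →L[ℝ] Mink m} {x : E} (hf : HasFDerivAt f f' x)
    (hg : HasFDerivAt g g' x) :
    ∃ D : E →L[ℝ] ℝ, HasFDerivAt (fun x => form (f x) (g x)) D x ∧
      ∀ v, D v = form (f' v) (g x) + form (f x) (g' v) := by
  refine ⟨_, (formL m).hasFDerivAt_of_bilinear hf hg, fun v => ?_⟩
  simp [formL_apply, add_comm]

theorem form_hypGrad_right (f : Mink m → ℝ) (x v : Mink m) :
    form (hypGrad f x) v = fderiv ℝ f x v + fderiv ℝ f x x * form x v := by
  rw [hypGrad, form_add_left, form_smul_left, form_minkGrad, form_minkGrad]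

theorem contDiff_minkGrad {f : Mink m → ℝ} (hf : ContDiff ℝ ∞ f) : ContDiff ℝ ∞ (minkGrad f) := by
  have h : ContDiff ℝ ∞ (fderiv ℝ f) := hf.fderiv_right (by simp)
  refine (h.clm_apply contDiff_const).neg.prodMk (contDiff_euclidean.2 fun i => ?_)
  exact h.clm_apply contDiff_const

theorem contDiff_hypGrad {f : Mink m → ℝ} (hf : ContDiff ℝ ∞ f) : ContDiff ℝ ∞ (hypGrad f) := by
  have h := contDiff_minkGrad hf
  rw [contDiff_iff_contDiffAt] at h ⊢
  intro x
  exact (h x).add ((contDiffAt_form (h x) contDiffAt_id).smul contDiffAt_id)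

theorem form_hypGrad_pos {f : Mink m → ℝ} {p : HSpace m}
    (hreg : ∃ X : Mink m, form p.1 X = 0 ∧ fderiv ℝ f p.1 X ≠ 0) :
    0 < form (hypGrad f p.1) (hypGrad f p.1) := by
  obtain ⟨X, h1, h2⟩ := hreg
  refine form_self_pos_of_tangent p (by rw [form_comm]; exact form_hypGrad f p) fun h0 => h2 ?_
  have := form_hypGrad_right f p.1 X
  rw [h0, h1, ← formL_apply, map_zero] at this
  simpa using this.symm

theorem contDiffAt_unitNormal {f : Mink m → ℝ} (hf : ContDiff ℝ ∞ f) {x : Mink m}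
    (hx : 0 < form (hypGrad f x) (hypGrad f x)) : ContDiffAt ℝ ∞ (unitNormal f) x := by
  have h := (contDiff_hypGrad hf).contDiffAt (x := x)
  exact (((contDiffAt_form h h).sqrt hx.ne').inv (Real.sqrt_pos.2 hx).ne').smul h

theorem eventually_form_hypGrad_pos {f : Mink m → ℝ} (hf : ContDiff ℝ ∞ f) {x : Mink m}
    (hx : 0 < form (hypGrad f x) (hypGrad f x)) :
    ∀ᶠ y in 𝓝 x, 0 < form (hypGrad f y) (hypGrad f y) :=
  continuousAt_const.eventually_lt
    (continuous_form (contDiff_hypGrad hf).continuous (contDiff_hypGrad hf).continuous).continuousAt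
    hx

theorem form_unitNormal_self {f : Mink m → ℝ} {x : Mink m}
    (hx : 0 < form (hypGrad f x) (hypGrad f x)) :
    form (unitNormal f x) (unitNormal f x) = 1 := by
  rw [unitNormal, form_smul_left, form_smul_right, ← mul_assoc, ← mul_inv,
    Real.mul_self_sqrt hx.le, inv_mul_cancel₀ hx.ne']

theorem form_unitNormal_base (f : Mink m → ℝ) (p : HSpace m) :
    form (unitNormal f p.1) p.1 = 0 := by
  rw [unitNormal, form_smul_left, form_hypGrad, mul_zero]

/-- On tangent vectors of `ℍ^m`, the differential of `f` is a positive multiple of the product with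
the unit normal. -/
theorem fderiv_eq_form_unitNormal {f : Mink m → ℝ} {p : HSpace m}
    (hp : 0 < form (hypGrad f p.1) (hypGrad f p.1)) {X : Mink m} (hX : form p.1 X = 0) :
    fderiv ℝ f p.1 X =
      Real.sqrt (form (hypGrad f p.1) (hypGrad f p.1)) * form (unitNormal f p.1) X := by
  rw [unitNormal, form_smul_left, ← mul_assoc, mul_inv_cancel₀ (Real.sqrt_pos.2 hp).ne', one_mul,
    form_hypGrad_right, hX, mul_zero, add_zero]

theorem isTangent_iff {f : Mink m → ℝ} {p : HSpace m}
    (hp : 0 < form (hypGrad f p.1) (hypGrad f p.1)) {X : Mink m} :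
    IsTangent f p X ↔ form p.1 X = 0 ∧ form (unitNormal f p.1) X = 0 := by
  refine and_congr_right fun h => ?_
  rw [fderiv_eq_form_unitNormal hp h, mul_eq_zero, or_iff_right (Real.sqrt_pos.2 hp).ne']

section Shape

variable {f : Mink m → ℝ} {p : HSpace m}

/-- The second fundamental form of a level set in terms of the second derivative of `f`. -/
theorem form_fderiv_unitNormal (hf : ContDiff ℝ ∞ f)
    (hp : 0 < form (hypGrad f p.1) (hypGrad f p.1)) (X : Mink m) {Y : Mink m}
    (hY : IsTangent f p Y) :
    form (fderiv ℝ (unitNormal f) p.1 X) Y =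
      (Real.sqrt (form (hypGrad f p.1) (hypGrad f p.1)))⁻¹ *
        (fderiv ℝ (fderiv ℝ f) p.1 X Y + fderiv ℝ f p.1 p.1 * form X Y) := by
  have hN := ((contDiffAt_unitNormal hf hp).differentiableAt (by simp)).hasFDerivAt
  obtain ⟨D, hD, hDv⟩ := hasFDerivAt_form hN (hasFDerivAt_const Y p.1)
  have h2 : ContDiff ℝ ∞ (fderiv ℝ f) := hf.fderiv_right (by simp)
  have hd2 := (h2.differentiable (by simp) p.1).hasFDerivAt
  have hρ : DifferentiableAt ℝ
      (fun x => (Real.sqrt (form (hypGrad f x) (hypGrad f x)))⁻¹) p.1 := by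
    have h := (contDiff_hypGrad hf).contDiffAt (x := p.1)
    exact (((contDiffAt_form h h).sqrt hp.ne').inv (Real.sqrt_pos.2 hp).ne').differentiableAt
      (by simp)
  have h3 : HasFDerivAt (fun x => fderiv ℝ f x Y) ((fderiv ℝ (fderiv ℝ f) p.1).flip Y) p.1 := by
    simpa using hd2.clm_apply (hasFDerivAt_const Y p.1)
  obtain ⟨D4, hD4, hD4v⟩ := hasFDerivAt_form (hasFDerivAt_id p.1) (hasFDerivAt_const Y p.1)
  have h5 : DifferentiableAt ℝ (fun x => fderiv ℝ f x x) p.1 :=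
    hd2.differentiableAt.clm_apply differentiableAt_id
  have h6 := hρ.hasFDerivAt.mul (h3.add (h5.hasFDerivAt.mul hD4))
  have heq : (fun x => form (unitNormal f x) Y) = fun x =>
      (Real.sqrt (form (hypGrad f x) (hypGrad f x)))⁻¹ *
        (fderiv ℝ f x Y + fderiv ℝ f x x * form x Y) := by
    funext x
    rw [unitNormal, form_smul_left, form_hypGrad_right f x Y]
  rw [heq] at hD
  have h7 := DFunLike.congr_fun (hD.unique h6) X
  rw [hDv] at h7
  have h8 : form (unitNormal f p.1) ((0 : Mink m →L[ℝ] Mink m) X) = 0 := by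
    rw [zero_apply, ← formL_apply, map_zero]
  have h9 : D4 X = form X Y := by
    rw [hD4v]
    simp only [zero_apply, ← formL_apply, map_zero]
    simp
  rw [h8, add_zero] at h7
  rw [h7]
  have h10 : form (id p.1) Y = 0 := hY.1
  simp only [add_apply, smul_apply, smul_eq_mul, Pi.add_apply, Pi.mul_apply, h9, h10, hY.2,
    ContinuousLinearMap.flip_apply]
  ring

theorem form_fderiv_unitNormal_symm (hf : ContDiff ℝ ∞ f)
    (hp : 0 < form (hypGrad f p.1) (hypGrad f p.1)) {X Y : Mink m} (hX : IsTangent f p X)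
    (hY : IsTangent f p Y) :
    form (fderiv ℝ (unitNormal f) p.1 X) Y = form (fderiv ℝ (unitNormal f) p.1 Y) X := by
  have hs : IsSymmSndFDerivAt ℝ f p.1 := hf.contDiffAt.isSymmSndFDerivAt
    (by rw [minSmoothness_of_isRCLikeNormedField]; exact ENat.LEInfty.out)
  rw [form_fderiv_unitNormal hf hp X hY, form_fderiv_unitNormal hf hp Y hX, form_comm Y X,
    hs.eq X Y]

/-- The shape operator maps tangent vectors to tangent vectors. -/
theorem isTangent_fderiv_unitNormal (hf : ContDiff ℝ ∞ f)
    (hp : 0 < form (hypGrad f p.1) (hypGrad f p.1)) {X : Mink m} (hX : IsTangent f p X) :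
    IsTangent f p (fderiv ℝ (unitNormal f) p.1 X) := by
  have hN := ((contDiffAt_unitNormal hf hp).differentiableAt (by simp)).hasFDerivAt
  rw [isTangent_iff hp] at hX ⊢
  constructor
  · obtain ⟨D, hD, hDv⟩ := hasFDerivAt_form hN (hasFDerivAt_id p.1)
    obtain ⟨D1, hD1, hD1v⟩ := hasFDerivAt_form (hasFDerivAt_id p.1) (hasFDerivAt_id p.1)
    have hρ : DifferentiableAt ℝ (fun x => (Real.sqrt (form (hypGrad f x) (hypGrad f x)))⁻¹ *
        fderiv ℝ f x x) p.1 := by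
      have h := (contDiff_hypGrad hf).contDiffAt (x := p.1)
      have h2 : ContDiff ℝ ∞ (fderiv ℝ f) := hf.fderiv_right (by simp)
      have h3 : DifferentiableAt ℝ (fun x => fderiv ℝ f x x) p.1 :=
        (h2.differentiable (by simp) p.1).clm_apply differentiableAt_id
      exact ((((contDiffAt_form h h).sqrt hp.ne').inv (Real.sqrt_pos.2 hp).ne').differentiableAt
        (by simp)).mul h3
    have heq : (fun x => form (unitNormal f x) (id x)) = fun x =>
        ((Real.sqrt (form (hypGrad f x) (hypGrad f x)))⁻¹ * fderiv ℝ f x x) *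
          (form (id x) (id x) + 1) := by
      funext x
      rw [unitNormal, form_smul_left, form_hypGrad_right f x (id x)]
      simp only [id]
      ring
    rw [heq] at hD
    have h7 := DFunLike.congr_fun (hD.unique (hρ.hasFDerivAt.mul (hD1.add_const 1))) X
    rw [hDv] at h7
    have h8 : D1 X = 0 := by
      rw [hD1v]
      simp only [id, ContinuousLinearMap.coe_id', form_comm X p.1, hX.1]
      ring
    have h9 : form (unitNormal f p.1) ((ContinuousLinearMap.id ℝ (Mink m)) X) = 0 := hX.2
    rw [h9, add_zero] at h7
    rw [form_comm]
    simp only [id] at h7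
    rw [h7]
    simp [h8, p.2.1]
  · obtain ⟨D, hD, hDv⟩ := hasFDerivAt_form hN hN
    have h1 : HasFDerivAt (fun x => form (unitNormal f x) (unitNormal f x))
        (0 : Mink m →L[ℝ] ℝ) p.1 := by
      refine (hasFDerivAt_const (1 : ℝ) p.1).congr_of_eventuallyEq ?_
      filter_upwards [eventually_form_hypGrad_pos hf hp] with y hy
      exact form_unitNormal_self hy
    have h2 := DFunLike.congr_fun (hD.unique h1) X
    rw [hDv, form_comm (fderiv ℝ (unitNormal f) p.1 X)] at h2
    simp only [zero_apply] at h2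
    linarith

end Shape

/-- The spectral theorem for the shape operator: principal curvatures exist, and the second
fundamental form is diagonal in an orthonormal basis of principal directions. -/
theorem exists_isPrincipalCurvatures {n : ℕ} {f : Mink (n + 1) → ℝ} {p : HSpace (n + 1)}
    (hf : ContDiff ℝ ∞ f) (hp : 0 < form (hypGrad f p.1) (hypGrad f p.1)) :
    ∃ κ : Fin n → ℝ, IsPrincipalCurvatures f p κ ∧ ∀ X, IsTangent f p X →
      ∃ a : Fin n → ℝ, form X X = ∑ i, a i ^ 2 ∧
        form (fderiv ℝ (unitNormal f) p.1 X) X = ∑ i, κ i * a i ^ 2 := by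
  have hNp : form p.1 (unitNormal f p.1) = 0 := by rw [form_comm]; exact form_unitNormal_base f p
  set ν := coframe p.1 (unitNormal f p.1) with hν
  have hν0 : ν ≠ 0 := by
    intro h0
    have := form_self_of_tangent p hNp
    rw [form_unitNormal_self hp, ← hν, h0] at this
    simp at this
  have hWt : ∀ a, a ∈ (ℝ ∙ ν)ᗮ ↔ IsTangent f p (frame p.1 a) := by
    intro a
    rw [Submodule.mem_orthogonal_singleton_iff_inner_right, isTangent_iff hp, form_self_frame,
      form_frame]
    simp [hν]
  let T : EuclideanSpace ℝ (Fin (n + 1)) →L[ℝ] EuclideanSpace ℝ (Fin (n + 1)) :=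
    (coframe p.1).comp ((fderiv ℝ (unitNormal f) p.1).comp (frame p.1))
  have hfT : ∀ a ∈ (ℝ ∙ ν)ᗮ, frame p.1 (T a) = fderiv ℝ (unitNormal f) p.1 (frame p.1 a) := by
    intro a ha
    exact (eq_frame_of_form_eq_zero p
      (isTangent_fderiv_unitNormal hf hp ((hWt a).1 ha)).1).symm
  have hTW : ∀ a ∈ (ℝ ∙ ν)ᗮ, T a ∈ (ℝ ∙ ν)ᗮ := by
    intro a ha
    rw [hWt, hfT a ha]
    exact isTangent_fderiv_unitNormal hf hp ((hWt a).1 ha)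
  let S : (ℝ ∙ ν)ᗮ →ₗ[ℝ] (ℝ ∙ ν)ᗮ := T.toLinearMap.restrict hTW
  have hSval : ∀ a, ((S a : (ℝ ∙ ν)ᗮ) : EuclideanSpace ℝ (Fin (n + 1))) = T a := fun a => rfl
  have hTi : ∀ a b, inner ℝ (T a) b
      = form (fderiv ℝ (unitNormal f) p.1 (frame p.1 a)) (frame p.1 b) := fun a b => by
    rw [form_frame]; rfl
  have hS : S.IsSymmetric := by
    intro a b
    rw [Submodule.coe_inner, Submodule.coe_inner, hSval, hSval, hTi, real_inner_comm, hTi]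
    exact form_fderiv_unitNormal_symm hf hp ((hWt _).1 a.2) ((hWt _).1 b.2)
  have hdim : Module.finrank ℝ (ℝ ∙ ν)ᗮ = n := by
    have : Fact (Module.finrank ℝ (EuclideanSpace ℝ (Fin (n + 1))) = n + 1) := ⟨by simp⟩
    exact Submodule.finrank_orthogonal_span_singleton hν0
  let b := hS.eigenvectorBasis hdim
  let κ := hS.eigenvalues hdim
  have hb : ∀ i, S (b i) = κ i • b i := fun i => hS.apply_eigenvectorBasis hdim i
  refine ⟨κ, ⟨fun i => frame p.1 (b i), fun i => (hWt _).1 (b i).2, fun i j => ?_, fun i => ?_⟩,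
    fun X hX => ?_⟩
  · rw [form_frame_frame, ← Submodule.coe_inner]
    exact orthonormal_iff_ite.1 b.orthonormal i j
  · rw [← hfT _ (b i).2, ← hSval, hb, Submodule.coe_smul, map_smul]
  · have hXf := eq_frame_of_form_eq_zero p hX.1
    have hxW : coframe p.1 X ∈ (ℝ ∙ ν)ᗮ := by rw [hWt, ← hXf]; exact hX
    let x : (ℝ ∙ ν)ᗮ := ⟨coframe p.1 X, hxW⟩
    have hxX : frame p.1 (x : EuclideanSpace ℝ (Fin (n + 1))) = X := hXf.symm
    refine ⟨fun i => inner ℝ (b i) x, ?_, ?_⟩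
    · rw [← hxX, form_frame_frame, ← Submodule.coe_inner, ← b.sum_inner_mul_inner x x]
      exact Finset.sum_congr rfl fun i _ => by rw [real_inner_comm (b i) x]; ring
    · rw [← hxX, ← hTi, ← hSval, ← Submodule.coe_inner, ← b.sum_inner_mul_inner (S x) x]
      refine Finset.sum_congr rfl fun i _ => ?_
      rw [hS x (b i), hb, inner_smul_right, real_inner_comm (b i) x]
      ring

/-- The pinching condition says that all principal curvatures lie between `H / 2 > 0` and
`(n + 1) H / 2`. -/
theorem pinched_bounds {n : ℕ} (hn : 0 < n) {κ : Fin n → ℝ}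
    (h : ∀ i, (1 / 2 : ℝ) * ((∑ j, κ j) / (n : ℝ)) < κ i) :
    ∃ μ : ℝ, 0 < μ ∧ ∀ i, μ ≤ κ i ∧ κ i ≤ ((n : ℝ) + 1) * μ := by
  have hn0 : (0 : ℝ) < n := by exact_mod_cast hn
  set μ : ℝ := (1 / 2 : ℝ) * ((∑ j, κ j) / (n : ℝ)) with hμ
  have hsum : ∑ j, κ j = 2 * n * μ := by rw [hμ]; field_simp
  have hne : (Finset.univ : Finset (Fin n)).Nonempty := ⟨⟨0, hn⟩, Finset.mem_univ _⟩
  have h1 : ∑ _j : Fin n, μ < ∑ j, κ j := Finset.sum_lt_sum_of_nonempty hne fun i _ => h i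
  rw [Finset.sum_const, Finset.card_univ, Fintype.card_fin, nsmul_eq_mul, hsum] at h1
  refine ⟨μ, by nlinarith, fun i => ⟨(h i).le, ?_⟩⟩
  have h2 := Finset.add_sum_erase Finset.univ κ (Finset.mem_univ i)
  have h3 : ∑ _j ∈ Finset.univ.erase i, μ ≤ ∑ j ∈ Finset.univ.erase i, κ j :=
    Finset.sum_le_sum fun j _ => (h j).le
  rw [Finset.sum_const, Finset.card_erase_of_mem (Finset.mem_univ i), Finset.card_univ,
    Fintype.card_fin, nsmul_eq_mul, Nat.cast_sub hn] at h3
  push_cast at h3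
  linarith

theorem IsStrictlyHalfPinched.form_bounds {n : ℕ} (hn : 0 < n) {K : Set (HSpace (n + 1))}
    (hK : IsStrictlyHalfPinched K) {p : HSpace (n + 1)} (hpK : p ∈ frontier K)
    {f : Mink (n + 1) → ℝ} (hf : IsDefiningFunctionAt K p f) :
    ∃ μ : ℝ, 0 < μ ∧ ∀ X, IsTangent f p X →
      μ * form X X ≤ form (fderiv ℝ (unitNormal f) p.1 X) X ∧
      form (fderiv ℝ (unitNormal f) p.1 X) X ≤ ((n : ℝ) + 1) * (μ * form X X) := by
  obtain ⟨κ, hκ, hdiag⟩ := exists_isPrincipalCurvatures hf.smooth (form_hypGrad_pos hf.regular)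
  obtain ⟨μ, hμ, hb⟩ := pinched_bounds hn (hK p hpK f hf κ hκ)
  refine ⟨μ, hμ, fun X hX => ?_⟩
  obtain ⟨a, h1, h2⟩ := hdiag X hX
  rw [h1, h2, Finset.mul_sum, Finset.mul_sum]
  refine ⟨Finset.sum_le_sum fun i _ => mul_le_mul_of_nonneg_right (hb i).1 (sq_nonneg _),
    Finset.sum_le_sum fun i _ => ?_⟩
  rw [← mul_assoc]
  exact mul_le_mul_of_nonneg_right (hb i).2 (sq_nonneg _)

/-! ### The boundary in the Klein model -/

/-- The differential of the inverse of the Klein chart. Up to a multiple of the position vector it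
is a multiple of `frame c`, and it distorts lengths between `g` and `g²`, where
`g = (1 - ‖x‖²)^(-1/2)`. -/
theorem fderiv_kleinMink (c : HSpace m) {x : EuclideanSpace ℝ (Fin m)} (hx : ‖x‖ < 1)
    (ξ : EuclideanSpace ℝ (Fin m)) :
    ∃ h : ℝ, fderiv ℝ (kleinMink c.1) x ξ =
        h • kleinMink c.1 x + (Real.sqrt (1 - ‖x‖ ^ 2))⁻¹ • frame c.1 ξ ∧
      form (kleinMink c.1 x) (fderiv ℝ (kleinMink c.1) x ξ) = 0 ∧
      ((Real.sqrt (1 - ‖x‖ ^ 2))⁻¹) ^ 2 * ‖ξ‖ ^ 2 ≤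
        form (fderiv ℝ (kleinMink c.1) x ξ) (fderiv ℝ (kleinMink c.1) x ξ) ∧
      form (fderiv ℝ (kleinMink c.1) x ξ) (fderiv ℝ (kleinMink c.1) x ξ) ≤
        ((Real.sqrt (1 - ‖x‖ ^ 2))⁻¹) ^ 2 * (((Real.sqrt (1 - ‖x‖ ^ 2))⁻¹) ^ 2 * ‖ξ‖ ^ 2) := by
  have hpos := one_sub_norm_sq_pos hx
  set g : ℝ := (Real.sqrt (1 - ‖x‖ ^ 2))⁻¹ with hg
  have hg0 : 0 < g := inv_pos.2 (Real.sqrt_pos.2 hpos)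
  have hg2 : g ^ 2 * (1 - ‖x‖ ^ 2) = 1 := by
    rw [hg, inv_pow, Real.sq_sqrt hpos.le, inv_mul_cancel₀ hpos.ne']
  obtain ⟨D, hD⟩ : ∃ D : EuclideanSpace ℝ (Fin m) →L[ℝ] ℝ,
      HasFDerivAt (fun x : EuclideanSpace ℝ (Fin m) => (Real.sqrt (1 - ‖x‖ ^ 2))⁻¹) D x := by
    have h1 : ContDiffAt ℝ 1 (fun x : EuclideanSpace ℝ (Fin m) => 1 - ‖x‖ ^ 2) x :=
      contDiffAt_const.sub (contDiff_norm_sq ℝ).contDiffAt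
    have h2 := (h1.sqrt hpos.ne').inv (Real.sqrt_pos.2 hpos).ne'
    exact ⟨_, (h2.differentiableAt (by norm_num)).hasFDerivAt⟩
  have hL : HasFDerivAt (kleinLift c.1) (frame c.1) x := (frame c.1).hasFDerivAt.const_add c.1
  have hder : fderiv ℝ (kleinMink c.1) x ξ = (D ξ / g) • kleinMink c.1 x + g • frame c.1 ξ := by
    have h1 : HasFDerivAt (kleinMink c.1) _ x := hD.smul hL
    rw [h1.fderiv]
    simp only [kleinMink, add_apply, smul_apply, ← hg, smul_smul, div_mul_cancel₀ _ hg0.ne']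
    simp [add_comm]
  set h : ℝ := D ξ / g with hh
  set q := kleinMink c.1 x with hq
  have hqq : form q q = -1 := (kleinMink_mem c hx).1
  have hqL : form q (frame c.1 ξ) = g * inner ℝ x ξ := by
    rw [hq, kleinMink, form_smul_left, kleinLift, form_add_left, form_self_frame, form_frame_frame,
      zero_add]
  have htan : form q (fderiv ℝ (kleinMink c.1) x ξ) = 0 := by
    have hk := ((contDiffAt_kleinMink c.1 hx).differentiableAt (by simp)).hasFDerivAt
    obtain ⟨D', hD', hDv⟩ := hasFDerivAt_form hk hk
    have h0 : HasFDerivAt (fun x => form (kleinMink c.1 x) (kleinMink c.1 x))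
        (0 : EuclideanSpace ℝ (Fin m) →L[ℝ] ℝ) x := by
      refine (hasFDerivAt_const (-1 : ℝ) x).congr_of_eventuallyEq ?_
      filter_upwards [eventually_norm_lt_one hx] with y hy
      exact (kleinMink_mem c hy).1
    have h2 := DFunLike.congr_fun (hD'.unique h0) ξ
    rw [hDv, form_comm (fderiv ℝ (kleinMink c.1) x ξ)] at h2
    simp only [zero_apply] at h2
    linarith
  have hhg : h = g ^ 2 * inner ℝ x ξ := by
    rw [hder, form_add_right, form_smul_right, form_smul_right, hqq, hqL] at htan
    linarith
  have hform : form (fderiv ℝ (kleinMink c.1) x ξ) (fderiv ℝ (kleinMink c.1) x ξ) =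
      g ^ 2 * ‖ξ‖ ^ 2 + h ^ 2 := by
    rw [hder]
    simp only [form_add_left, form_add_right, form_smul_left, form_smul_right, hqq, hqL,
      form_comm (frame c.1 ξ) q, form_frame_frame, real_inner_self_eq_norm_sq]
    have : g ^ 2 * inner ℝ x ξ * h = h ^ 2 := by rw [← hhg]; ring
    linarith
  refine ⟨h, hder, htan, ?_, ?_⟩
  · rw [hform]; nlinarith [sq_nonneg h]
  · rw [hform, hhg]
    have h1 : inner ℝ x ξ ^ 2 ≤ ‖x‖ ^ 2 * ‖ξ‖ ^ 2 := by
      rw [← mul_pow, ← sq_abs]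
      exact pow_le_pow_left₀ (abs_nonneg _) (abs_real_inner_le_norm _ _) 2
    have h2 := mul_le_mul_of_nonneg_left h1 (by positivity : 0 ≤ (g ^ 2) ^ 2)
    have h3 : (g ^ 2) ^ 2 * ‖x‖ ^ 2 = (g ^ 2) ^ 2 - g ^ 2 := by
      have : (g ^ 2) ^ 2 * ‖x‖ ^ 2 = g ^ 2 * (g ^ 2 - g ^ 2 * (1 - ‖x‖ ^ 2)) := by ring
      rw [this, hg2]; ring
    have h4 : (g ^ 2) ^ 2 * (‖x‖ ^ 2 * ‖ξ‖ ^ 2) = ((g ^ 2) ^ 2 - g ^ 2) * ‖ξ‖ ^ 2 := by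
      rw [← h3]; ring
    rw [mul_pow]
    linarith

/-- The Euclidean normal field, in the Klein model centred at `c`, of the level sets of `f`. -/
def kleinNormal (c : Mink m) (f : Mink m → ℝ) (x : EuclideanSpace ℝ (Fin m)) :
    EuclideanSpace ℝ (Fin m) :=
  coframe c (unitNormal f (kleinMink c x))

theorem fderiv_comp_kleinMink {c : HSpace m} {f : Mink m → ℝ} (hf : ContDiff ℝ ∞ f)
    {x : EuclideanSpace ℝ (Fin m)} (hx : ‖x‖ < 1)
    (hp : 0 < form (hypGrad f (kleinMink c.1 x)) (hypGrad f (kleinMink c.1 x))) :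
    ∃ k : ℝ, 0 < k ∧ ∀ ξ, fderiv ℝ (fun y => f (kleinMink c.1 y)) x ξ =
      k * inner ℝ (kleinNormal c.1 f x) ξ := by
  have hpos := one_sub_norm_sq_pos hx
  rw [← klein_val c hx] at hp
  refine ⟨Real.sqrt (form (hypGrad f (klein c x).1) (hypGrad f (klein c x).1)) *
    (Real.sqrt (1 - ‖x‖ ^ 2))⁻¹, mul_pos (Real.sqrt_pos.2 hp) (inv_pos.2 (Real.sqrt_pos.2 hpos)),
    fun ξ => ?_⟩
  obtain ⟨h, h1, h2, -, -⟩ := fderiv_kleinMink c hx ξ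
  have hk := ((contDiffAt_kleinMink c.1 hx).differentiableAt (by simp)).hasFDerivAt
  have hfd := (hf.differentiable (by simp) (kleinMink c.1 x)).hasFDerivAt
  have h3 : HasFDerivAt (fun y => f (kleinMink c.1 y)) _ x := hfd.comp x hk
  have h4 := form_unitNormal_base f (klein c x)
  rw [h3.fderiv, ContinuousLinearMap.comp_apply]
  rw [← klein_val c hx] at h1 h2 ⊢
  rw [fderiv_eq_form_unitNormal hp h2, h1, form_add_right, form_smul_right, h4, form_smul_right,
    form_frame, kleinNormal, klein_val c hx]
  ring

theorem kleinNormal_ne_zero {c : HSpace m} {f : Mink m → ℝ} {x : EuclideanSpace ℝ (Fin m)}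
    (hp : 0 < form (hypGrad f (kleinMink c.1 x)) (hypGrad f (kleinMink c.1 x))) :
    kleinNormal c.1 f x ≠ 0 := by
  intro h0
  have h1 := form_unitNormal_self hp
  have h2 := eq_smul_add_frame c (unitNormal f (kleinMink c.1 x))
  rw [kleinNormal] at h0
  rw [h0, map_zero, add_zero] at h2
  rw [h2, form_smul_left, form_smul_right, c.2.1] at h1
  nlinarith [sq_nonneg (form c.1 (unitNormal f (kleinMink c.1 x)))]

/-- Pinched principal curvatures in `ℍ^{n+1}` give a pinched Euclidean second fundamental form in
the Klein model: the two second fundamental forms are proportional, and the two metrics differ by a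
factor between `cosh² d` and `cosh⁴ d`, where `d` is the distance from the centre. -/
theorem isPinchedNormalAt_kleinNormal {n : ℕ} (hn : 0 < n) {K : Set (HSpace (n + 1))}
    (hpinched : IsStrictlyHalfPinched K) {c : HSpace (n + 1)} {R : ℝ} (hR : 0 ≤ R)
    (hsub : K ⊆ geodesicBall c R) (hK : IsClosed K) {x : EuclideanSpace ℝ (Fin (n + 1))}
    (hx : ‖x‖ < 1) (hxK : klein c x ∈ frontier K) {f : Mink (n + 1) → ℝ}
    (hf : IsDefiningFunctionAt K (klein c x) f) :
    IsPinchedNormalAt (kleinCoord c '' K) (((n : ℝ) + 1) * Real.cosh R ^ 2) x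
      (kleinNormal c.1 f) (fun y => f (kleinMink c.1 y)) := by
  have hpos := one_sub_norm_sq_pos hx
  have hp := form_hypGrad_pos hf.regular
  have hkc := contDiffAt_kleinMink c.1 hx
  have hp' := hp
  rw [klein_val c hx] at hp'
  have hNs : ContDiffAt ℝ ∞ (fun y => unitNormal f (kleinMink c.1 y)) x :=
    (contDiffAt_unitNormal hf.smooth hp').comp x hkc
  have hνs : ContDiffAt ℝ ∞ (kleinNormal c.1 f) x :=
    (coframe c.1).contDiff.contDiffAt.comp x hNs
  have hle : (1 : WithTop ℕ∞) ≤ ∞ := ENat.LEInfty.out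
  set g : ℝ := (Real.sqrt (1 - ‖x‖ ^ 2))⁻¹ with hg
  have hg0 : 0 < g := inv_pos.2 (Real.sqrt_pos.2 hpos)
  -- the derivative of the Euclidean normal is a multiple of the shape operator
  have hνd : ∀ ξ ζ, inner ℝ (kleinNormal c.1 f x) ξ = 0 → inner ℝ (kleinNormal c.1 f x) ζ = 0 →
      IsTangent f (klein c x) (fderiv ℝ (kleinMink c.1) x ξ) ∧
      inner ℝ (fderiv ℝ (kleinNormal c.1 f) x ξ) ζ =
        g⁻¹ * form (fderiv ℝ (unitNormal f) (klein c x).1 (fderiv ℝ (kleinMink c.1) x ξ))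
          (fderiv ℝ (kleinMink c.1) x ζ) := by
    intro ξ ζ hξ hζ
    have hT : IsTangent f (klein c x) (fderiv ℝ (kleinMink c.1) x ξ) := by
      obtain ⟨h, h1, h2, -⟩ := fderiv_kleinMink c hx ξ
      have h4 := form_unitNormal_base f (klein c x)
      rw [isTangent_iff hp]
      refine ⟨by rw [klein_val c hx]; exact h2, ?_⟩
      rw [h1, form_add_right, form_smul_right, form_smul_right, form_frame, ← klein_val c hx, h4,
        klein_val c hx]
      change h * 0 + g * inner ℝ (kleinNormal c.1 f x) ξ = 0
      rw [hξ]; ring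
    refine ⟨hT, ?_⟩
    have hNd := ((contDiffAt_unitNormal hf.smooth hp').differentiableAt (by simp)).hasFDerivAt
    have h5 : HasFDerivAt (kleinNormal c.1 f) _ x :=
      (coframe c.1).hasFDerivAt.comp x
        (HasFDerivAt.comp x hNd (hkc.differentiableAt (by simp)).hasFDerivAt)
    have hT2 := (isTangent_fderiv_unitNormal hf.smooth hp hT).1
    obtain ⟨h, h1, -⟩ := fderiv_kleinMink c hx ζ
    rw [h5.fderiv, ContinuousLinearMap.comp_apply, ContinuousLinearMap.comp_apply, ← form_frame,
      h1, form_add_right, form_smul_right, form_smul_right, ← klein_val c hx,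
      form_comm _ (klein c x).1, hT2, mul_zero, zero_add, ← hg, inv_mul_cancel_left₀ hg0.ne']
  refine ⟨hνs.of_le hle, (hf.smooth.contDiffAt.comp x hkc).of_le hle, ?_, ?_, ?_, ?_⟩
  · obtain ⟨k, hk, h⟩ := fderiv_comp_kleinMink hf.smooth hx hp'
    exact ⟨k, hk.ne', h⟩
  · have e1 := (continuousAt_klein c hx).eventually hf.mem_iff.eventually_nhds
    have e2 := hkc.continuousAt.eventually (eventually_form_hypGrad_pos hf.smooth hp')
    filter_upwards [eventually_norm_lt_one hx, e1, e2] with y hy h1 h2 u hu hsupp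
    obtain ⟨k, hk, h⟩ := fderiv_comp_kleinMink hf.smooth hy h2
    refine hsupp.exists_smul_eq hu (F := fun y => f (kleinMink c.1 y)) ?_ hk
      (kleinNormal_ne_zero h2) h ?_
    · exact DifferentiableAt.comp y (hf.smooth.differentiable (by simp) _)
        ((contDiffAt_kleinMink c.1 hy).differentiableAt (by simp))
    · filter_upwards [eventually_norm_lt_one hy, (continuousAt_klein c hy).eventually h1]
        with z hz h3
      rw [mem_image_kleinCoord, ← klein_val c hz, ← h3]
      exact and_iff_right hz
  · intro ξ ζ hξ hζ
    obtain ⟨t1, e1⟩ := hνd ξ ζ hξ hζ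
    obtain ⟨t2, e2⟩ := hνd ζ ξ hζ hξ
    rw [e1, e2, form_fderiv_unitNormal_symm hf.smooth hp t1 t2]
  · obtain ⟨μ, hμ, hb⟩ := hpinched.form_bounds hn hxK hf
    have hgR : g ^ 2 ≤ Real.cosh R ^ 2 := by
      have h1 := one_sub_norm_kleinCoord_sq c (klein c x)
      rw [kleinCoord_klein c hx] at h1
      have h2 := (mem_geodesicBall hR).1 (hsub (hK.frontier_subset hxK))
      have h3 := one_le_neg_form c (klein c x)
      rw [hg, h1, Real.sqrt_sq (by positivity), inv_inv]
      exact pow_le_pow_left₀ (by linarith) h2 2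
    refine ⟨g⁻¹ * μ * g ^ 2, by positivity, fun ξ hξ => ?_⟩
    obtain ⟨t1, e1⟩ := hνd ξ ξ hξ hξ
    obtain ⟨-, -, -, b1, b2⟩ := fderiv_kleinMink c hx ξ
    rw [← hg] at b1 b2
    obtain ⟨c1, c2⟩ := hb _ t1
    rw [e1]
    have hgi : 0 < g⁻¹ := inv_pos.2 hg0
    constructor
    · calc g⁻¹ * μ * g ^ 2 * ‖ξ‖ ^ 2 = g⁻¹ * (μ * (g ^ 2 * ‖ξ‖ ^ 2)) := by ring
        _ ≤ _ := by gcongr; exact (mul_le_mul_of_nonneg_left b1 hμ.le).trans c1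
    · refine (mul_le_mul_of_nonneg_left c2 hgi.le).trans ?_
      calc g⁻¹ * (((n : ℝ) + 1) * (μ * _))
          ≤ g⁻¹ * (((n : ℝ) + 1) * (μ * (g ^ 2 * (g ^ 2 * ‖ξ‖ ^ 2)))) := by gcongr
        _ ≤ g⁻¹ * (((n : ℝ) + 1) * (μ * (Real.cosh R ^ 2 * (g ^ 2 * ‖ξ‖ ^ 2)))) := by gcongr
        _ = _ := by ring

/-! ### The inradius bound -/

theorem mem_frontier_of_isSupportPoint {m : ℕ} {K : Set (HSpace m)} {c : HSpace m}
    {u x : EuclideanSpace ℝ (Fin m)} (hu : u ≠ 0)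
    (h : IsSupportPoint (kleinCoord c '' K) u x) : klein c x ∈ frontier K := by
  obtain ⟨hx, hxK⟩ := mem_image_kleinCoord.1 h.mem
  refine ⟨subset_closure hxK, fun hint => h.notMem_nhds hu ?_⟩
  have h1 := (continuousAt_klein c hx).eventually (mem_interior_iff_mem_nhds.1 hint)
  filter_upwards [h1, eventually_norm_lt_one hx] with y hy1 hy2
  exact mem_image_kleinCoord.2 ⟨hy2, hy1⟩

/-- All widths of `K` in the Klein model centred at the circumcentre are at least
`√2 tanh R / ((n + 1) cosh² R)`. -/
theorem exists_width_ge {n : ℕ} (hn : 2 ≤ n) {K : Set (HSpace (n + 1))}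
    (hcompact : IsCompact K) (hne : K.Nonempty) (hconv : GeodesicallyConvex K)
    (hsmooth : HasSmoothBoundary K) (hpinched : IsStrictlyHalfPinched K)
    {c : HSpace (n + 1)} {R : ℝ} (hR0 : 0 ≤ R) (hsub : K ⊆ geodesicBall c R)
    (hmin : ∀ (c' : HSpace (n + 1)) (r : ℝ), 0 ≤ r → K ⊆ geodesicBall c' r → R ≤ r)
    {v : EuclideanSpace ℝ (Fin (n + 1))} (hv : ‖v‖ = 1) :
    ∃ a ∈ kleinCoord c '' K, ∃ b ∈ kleinCoord c '' K,
      Real.sqrt 2 * Real.tanh R / (((n : ℝ) + 1) * Real.cosh R ^ 2) ≤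
        inner ℝ a v - inner ℝ b v := by
  set C := kleinCoord c '' K with hC
  set A : ℝ := ((n : ℝ) + 1) * Real.cosh R ^ 2 with hA
  have hA1 : 1 ≤ A := by
    have h1 := one_le_pow₀ (Real.one_le_cosh R) (n := 2)
    have h2 : (0 : ℝ) ≤ n := Nat.cast_nonneg n
    nlinarith
  obtain ⟨X, hX, hd, hp, hpinch⟩ := exists_supportPoint_differentiable (A := A)
    (hcompact.image (continuous_kleinCoord c)) (convex_image_kleinCoord hconv c) (hne.image _)
    (fun u x hu hux => by
      have hfr := mem_frontier_of_isSupportPoint hu hux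
      obtain ⟨f, hf⟩ := hsmooth _ hfr
      exact ⟨_, _, isPinchedNormalAt_kleinNormal (by omega) hpinched hR0 hsub hcompact.isClosed
        (mem_image_kleinCoord.1 hux.mem).1 hfr hf⟩)
  have hM : ∀ x ∈ C, ‖x‖ ≤ 1 := fun x hx => (mem_image_kleinCoord.1 hx).1.le
  have hv0 : v ≠ 0 := by rintro rfl; simp at hv
  have hnv0 : -v ≠ 0 := neg_ne_zero.2 hv0
  refine ⟨X v, (hX v hv0).mem, X (-v), (hX _ hnv0).mem, ?_⟩
  obtain ⟨a, ha, b, hb, hab⟩ := exists_far_points n.succ_pos hcompact hne hR0 hsub hmin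
  rw [div_le_iff₀ (by linarith)]
  by_cases h0 : a = b
  · rw [h0, sub_self, norm_zero] at hab
    have hw : 0 ≤ inner ℝ (X v) v - inner ℝ (X (-v)) v :=
      sub_nonneg.2 ((hX v hv0).le _ (hX _ hnv0).mem)
    have := mul_nonneg hw (by linarith : 0 ≤ A)
    linarith
  · have hpos : 0 < ‖a - b‖ := norm_pos_iff.2 (sub_ne_zero.2 h0)
    set u := ‖a - b‖⁻¹ • (a - b) with hu
    have hu1 : ‖u‖ = 1 := by
      rw [hu, norm_smul, norm_inv, norm_norm, inv_mul_cancel₀ hpos.ne']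
    have hu0 : u ≠ 0 := by intro h; rw [h, norm_zero] at hu1; exact zero_ne_one hu1
    have h1 := width_le_mul_width hA1 (by simpa using hn) hM hX hd hp hpinch hu1 hv
    have h2 := (hX u hu0).le a ha
    have h3 := (hX _ (neg_ne_zero.2 hu0)).le b hb
    rw [inner_neg_right, inner_neg_right] at h3
    have h4 : inner ℝ a u - inner ℝ b u = ‖a - b‖ := by
      rw [← inner_sub_left, hu, inner_smul_right, real_inner_self_eq_norm_sq]
      field_simp
    linarith

theorem exists_geodesicBall_subset {n : ℕ} (hn : 2 ≤ n) {K : Set (HSpace (n + 1))}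
    (hcompact : IsCompact K) (hne : K.Nonempty) (hconv : GeodesicallyConvex K)
    (hsmooth : HasSmoothBoundary K) (hpinched : IsStrictlyHalfPinched K) {R : ℝ}
    (hR : IsOutradius K R) :
    ∃ c : HSpace (n + 1), geodesicBall c
      (Real.sqrt 2 / (((n : ℝ) + 1) * ((n : ℝ) + 2)) * (Real.tanh R / Real.cosh R ^ 2)) ⊆ K := by
  obtain ⟨⟨hR0, c, hsub⟩, hlow⟩ := hR
  have hmin : ∀ (c' : HSpace (n + 1)) (r : ℝ), 0 ≤ r → K ⊆ geodesicBall c' r → R ≤ r :=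
    fun c' r hr h => hlow ⟨hr, c', h⟩
  obtain ⟨z, hz⟩ := exists_closedBall_subset_of_width
    (hcompact.image (continuous_kleinCoord c)) (convex_image_kleinCoord hconv c) (hne.image _)
    (by simp) (fun v hv => exists_width_ge hn hcompact hne hconv hsmooth hpinched hR0 hsub hmin hv)
  have ht : 0 ≤ Real.tanh R := by
    rw [Real.tanh_eq_sinh_div_cosh]
    exact div_nonneg (Real.sinh_nonneg_iff.2 hR0) (Real.cosh_pos R).le
  have hc := Real.cosh_pos R
  refine ⟨klein c z, geodesicBall_klein_subset (by positivity) ?_⟩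
  have hrad : Real.sqrt 2 / (((n : ℝ) + 1) * ((n : ℝ) + 2)) * (Real.tanh R / Real.cosh R ^ 2) =
      Real.sqrt 2 * Real.tanh R / (((n : ℝ) + 1) * Real.cosh R ^ 2) / (((n + 1 : ℕ) : ℝ) + 1) := by
    push_cast
    field_simp
    ring
  rw [finrank_euclideanSpace, Fintype.card_fin] at hz
  rwa [hrad]

end Hyp

end

theorem corollary2p5 (n : ℕ) (hn : 2 ≤ n) (K : Set (Hyp.HSpace (n + 1)))
    (hcompact : IsCompact K) (hint : (interior K).Nonempty) (hconv : Hyp.GeodesicallyConvex K)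
    (hsmooth : Hyp.HasSmoothBoundary K) (hpinched : Hyp.IsStrictlyHalfPinched K)
    (R : ℝ) (hR : Hyp.IsOutradius K R) :
    (∃ c : Hyp.HSpace (n + 1),
      Hyp.geodesicBall c
        (Real.sqrt 2 / (((n : ℝ) + 1) * ((n : ℝ) + 2)) * (Real.tanh R / Real.cosh R ^ 2)) ⊆ K) ∧
    (R = Real.artanh (1 / Real.sqrt 3) →
      Real.sqrt 2 / (((n : ℝ) + 1) * ((n : ℝ) + 2)) * (Real.tanh R / Real.cosh R ^ 2)
          = Real.sqrt (8 / 27) * (1 / (((n : ℝ) + 1) * ((n : ℝ) + 2))) ∧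
      ∃ c : Hyp.HSpace (n + 1),
        Hyp.geodesicBall c (Real.sqrt (8 / 27) * (1 / (((n : ℝ) + 1) * ((n : ℝ) + 2)))) ⊆ K) := by
  have hball := Hyp.exists_geodesicBall_subset hn hcompact (hint.mono interior_subset) hconv hsmooth
    hpinched hR
  refine ⟨hball, fun hRval => ?_⟩
  have hs3 : Real.sqrt 3 ^ 2 = 3 := Real.sq_sqrt (by norm_num)
  have hs0 : 0 < Real.sqrt 3 := Real.sqrt_pos.2 (by norm_num)
  have h1 : 1 / Real.sqrt 3 ∈ Ioo (-1 : ℝ) 1 := by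
    have hs1 : 1 < Real.sqrt 3 := by nlinarith
    have h0 : 0 < 1 / Real.sqrt 3 := by positivity
    exact ⟨by linarith, (div_lt_one hs0).2 hs1⟩
  have htanh : Real.tanh R = 1 / Real.sqrt 3 := by rw [hRval, Real.tanh_artanh h1]
  have hcosh : Real.cosh R ^ 2 = 3 / 2 := by
    have h2 := Real.cosh_sq R
    have h3 : Real.tanh R ^ 2 * Real.cosh R ^ 2 = Real.sinh R ^ 2 := by
      rw [Real.tanh_eq_sinh_div_cosh, div_pow,
        div_mul_cancel₀ _ (pow_ne_zero 2 (Real.cosh_pos R).ne')]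
    rw [htanh, div_pow, hs3] at h3
    linarith
  have hsqrt : Real.sqrt (8 / 27) = Real.sqrt 2 * (1 / Real.sqrt 3 / (3 / 2)) := by
    rw [Real.sqrt_eq_iff_mul_self_eq (by norm_num) (by positivity)]
    have hs2 : Real.sqrt 2 ^ 2 = 2 := Real.sq_sqrt (by norm_num)
    field_simp
    rw [hs2, hs3]
    norm_num
  have heq : Real.sqrt 2 / (((n : ℝ) + 1) * ((n : ℝ) + 2)) * (Real.tanh R / Real.cosh R ^ 2)
      = Real.sqrt (8 / 27) * (1 / (((n : ℝ) + 1) * ((n : ℝ) + 2))) := by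
    rw [htanh, hcosh, hsqrt]
    ring
  exact ⟨heq, heq ▸ hball⟩
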